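/- **Improved Bochner inequality.** Let $M$ be a connected $n$-dimensional $C^\infty$-manifold without boundary, $n\ge 2$, let $\mathfrak m$ be a positive $C^\infty$-measure on $M$ (in every chart $d\mathfrak m=e^{\Phi}\,dx^1\cdots dx^n$ with $\Phi$ smooth), and let $F:TM\to[0,\infty)$ be a $C^\infty$-Finsler structure: $F$ is $C^\infty$ on $TM\setminus 0$, $F(cv)=cF(v)$ for all $c\ge 0$, and $g_{ij}(v)=\frac12\frac{\partial^2(F^2)}{\partial v^i\partial v^j}(v)$ is positive definite for $v\ne0$ ($F$ is not assumed reversible). Write $(g^{ij})$ for the inverse matrix of $(g_{ij})$. For $u:M\to\mathbb R$ differentiable, let $\boldsymbol\nabla u(x)\in T_xM$ be the Legendre transform of $Du(x)$, i.e. the unique $v\in T_xM$ with $F(v)=F^*(Du(x))$ and $Du(x)(v)=F^*(Du(x))^2$, where $F^*(\alpha)=\sup\{\alpha(w): w\in T_xM,\ F(w)\le1\}$. For a vector field $V$ let $\operatorname{div}_{\mathfrak m}V=\sum_i\big(\frac{\partial V^i}{\partial x^i}+V^i\frac{\partial\Phi}{\partial x^i}\big)$, and put $\boldsymbol\Delta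 u=\operatorname{div}_{\mathfrak m}(\boldsymbol\nabla u)$, $\nabla^{V}f=\sum_{i,j}g^{ij}(V)\frac{\partial f}{\partial x^j}\frac{\partial}{\partial x^i}$ and $\Delta^{V}f=\operatorname{div}_{\mathfrak m}(\nabla^{V}f)$ where $V\neq0$. Let $\gamma^i_{jk}=\frac12\sum_l g^{il}\big(\frac{\partial g_{lk}}{\partial x^j}+\frac{\partial g_{jl}}{\partial x^k}-\frac{\partial g_{jk}}{\partial x^l}\big)$, $G^i(v)=\sum_{j,k}\gamma^i_{jk}(v)v^jv^k$ and $N^i_j=\frac12\frac{\partial G^i}{\partial v^j}$. The Finsler Ricci curvature of $v\in TM\setminus 0$ is the trace $\mathrm{Ric}(v)=\sum_i R^i_i(v)$ of the Riemann (flag) curvature $$R^i_k=\frac{\partial G^i}{\partial x^k}-\sum_j v^j\frac{\partial N^i_k}{\partial x^j}+\sum_j G^j\frac{\partial N^i_k}{\partial v^j}-\sum_j N^i_jN^j_k .$$ For $v\in T_xM\setminus0$ let $\eta$ be the geodesic ($\ddot\eta^i+G^i(\dot\eta)=0$) with $\dot\eta(0)=v$, and let $\Psi$ be the function along $\eta$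 with $\mathfrak m=e^{-\Psi}\mathrm{vol}_{g_{\dot\eta}}$, i.e. $e^{\Phi(\eta)}=e^{-\Psi}\sqrt{\det (g_{ij}(\dot\eta))}$; set $\mathrm{Ric}_\infty(v)=\mathrm{Ric}(v)+(\Psi\circ\eta)''(0)$ and $\mathrm{Ric}_\infty(0)=0$. The condition $\mathrm{Ric}_\infty\ge K$ means $\mathrm{Ric}_\infty(v)\ge K F^2(v)$ for all $v\in TM$. **Claim.** If $\mathrm{Ric}_\infty\ge K$ for some $K\in\mathbb R$, then for every $u\in C^\infty(M)$ and at every point of $M_u=\{x\in M: Du(x)\ne0\}$, $$\Delta^{\boldsymbol\nabla u}\Big[\frac{F^2(\boldsymbol\nabla u)}2\Big]-D[\boldsymbol\Delta u](\boldsymbol\nabla u)-K F^2(\boldsymbol\nabla u)\ \ge\ D[F(\boldsymbol\nabla u)]\big(\nabla^{\boldsymbol\nabla u}[F(\boldsymbol\nabla u)]\big).$$ -/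

import Mathlib

open scoped Manifold ContDiff

noncomputable section

namespace Finsler

/-- The model space `ℝⁿ`. -/
abbrev Model (n : ℕ) : Type := EuclideanSpace ℝ (Fin n)

/-- The coordinate vector `∂/∂xⁱ` of `ℝⁿ`. -/
def basisVec {n : ℕ} (i : Fin n) : Model n := EuclideanSpace.single i 1

/-- `½ D²(f²)(v)[a, b]`, the Hessian of `f² / 2` at `v` evaluated on `a, b`. -/
def halfHess {n : ℕ} (f : Model n → ℝ) (v a b : Model n) : ℝ :=
  (1 / 2) * fderiv ℝ (fun w => fderiv ℝ (fun z => f z ^ 2) w b) v a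

/-- The matrix `g_{ij}(v) = ½ ∂²(f²)/∂vⁱ∂vʲ (v)`. -/
def gMatrix {n : ℕ} (f : Model n → ℝ) (v : Model n) : Matrix (Fin n) (Fin n) ℝ :=
  Matrix.of fun i j => halfHess f v (basisVec i) (basisVec j)

/-! ### Coordinate expressions

Here `f x v` is the coordinate expression of a Finsler structure in the fibre-wise linear
coordinates `(xⁱ, vʲ)` of the tangent bundle over a chart domain. -/

section Coordinates

variable {n : ℕ}

/-- `∂H/∂xⁱ (x, v)`. -/
def pdx (i : Fin n) (H : Model n → Model n → ℝ) (x v : Model n) : ℝ :=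
  fderiv ℝ (fun y => H y v) x (basisVec i)

/-- `∂H/∂vⁱ (x, v)`. -/
def pdv (i : Fin n) (H : Model n → Model n → ℝ) (x v : Model n) : ℝ :=
  fderiv ℝ (fun w => H x w) v (basisVec i)

/-- `g_{ij}(x, v)`. -/
def gLow (f : Model n → Model n → ℝ) (i j : Fin n) (x v : Model n) : ℝ :=
  gMatrix (f x) v i j

/-- `g^{ij}(x, v)`, the inverse matrix. -/
def gUp (f : Model n → Model n → ℝ) (i j : Fin n) (x v : Model n) : ℝ :=
  (gMatrix (f x) v)⁻¹ i j

/-- The formal Christoffel symbols `γⁱ_{jk}(x, v)`. -/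
def formalChristoffel (f : Model n → Model n → ℝ) (i j k : Fin n) (x v : Model n) : ℝ :=
  (1 / 2) * ∑ l, gUp f i l x v *
    (pdx j (gLow f l k) x v + pdx k (gLow f j l) x v - pdx l (gLow f j k) x v)

/-- The geodesic spray coefficients `Gⁱ = ∑ γⁱ_{jk} vʲ vᵏ`. -/
def spray (f : Model n → Model n → ℝ) (i : Fin n) (x v : Model n) : ℝ :=
  ∑ j, ∑ k, formalChristoffel f i j k x v * v j * v k

/-- The nonlinear connection `Nⁱ_j = ½ ∂Gⁱ/∂vʲ`. -/
def nonlinConn (f : Model n → Model n → ℝ) (i j : Fin n) (x v : Model n) : ℝ :=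
  (1 / 2) * pdv j (spray f i) x v

/-- The Riemann (flag) curvature
`Rⁱ_k = ∂Gⁱ/∂xᵏ - ∑ vʲ ∂Nⁱ_k/∂xʲ + ∑ Gʲ ∂Nⁱ_k/∂vʲ - ∑ Nⁱ_j Nʲ_k`; the flag curvature of the
flag spanned by `v, w` is `g_v(R_v w, w) / (g_v(v, v) g_v(w, w) - g_v(v, w)²)`. -/
def riemannCurv (f : Model n → Model n → ℝ) (i k : Fin n) (x v : Model n) : ℝ :=
  pdx k (spray f i) x v
    - ∑ j, v j * pdx j (nonlinConn f i k) x v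
    + ∑ j, spray f j x v * pdv j (nonlinConn f i k) x v
    - ∑ j, nonlinConn f i j x v * nonlinConn f j k x v

/-- The Ricci curvature `Ric(v) = ∑ Rⁱ_i(v)`, the trace of the flag curvature. -/
def ricciCoord (f : Model n → Model n → ℝ) (x v : Model n) : ℝ :=
  ∑ i, riemannCurv f i i x v

/-- The function `Ψ` with `e^{Φ} dx = e^{-Ψ} √det g_{ij}(v) dx`: the measure with density `e^{Φ}`
is `e^{-Ψ} vol_{g_V}` at a point `x` where the vector field `V` takes the value `v`. -/
def weightCoord (f : Model n → Model n → ℝ) (Φ : Model n → ℝ) (x v : Model n) : ℝ :=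
  Real.log (Real.sqrt (gMatrix (f x) v).det) - Φ x

end Coordinates

/-! ### Finsler manifolds -/

/-- A `C^∞` Finsler structure on `M`. -/
structure FinslerStructure (n : ℕ) (M : Type*) [TopologicalSpace M]
    [ChartedSpace (Model n) M] [IsManifold (𝓡 n) ∞ M] where
  /-- The function `F` on the tangent bundle. -/
  toFun : (x : M) → TangentSpace (𝓡 n) x → ℝ
  nonneg : ∀ x v, 0 ≤ toFun x v
  /-- Smooth away from the zero section. -/
  smooth : ContMDiffOn (𝓡 n).tangent 𝓘(ℝ, ℝ) ∞
    (fun p : TangentBundle (𝓡 n) M => toFun p.1 p.2) {p | p.2 ≠ 0}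
  /-- Positive 1-homogeneity. -/
  homogeneous : ∀ (x : M) (v : TangentSpace (𝓡 n) x) (c : ℝ), 0 ≤ c →
    toFun x (c • v) = c * toFun x v
  /-- Strong convexity: `g_v` is positive definite for `v ≠ 0`. -/
  stronglyConvex : ∀ (x : M) (v w : TangentSpace (𝓡 n) x), v ≠ 0 → w ≠ 0 →
    0 < halfHess (n := n) (toFun x) v w w

section Manifold

variable {n : ℕ} {M : Type*} [TopologicalSpace M] [ChartedSpace (Model n) M]
  [IsManifold (𝓡 n) ∞ M]

/-- The coordinate expression of `F` in the chart `e`. -/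
def FinslerStructure.inChart (F : FinslerStructure n M) (e : OpenPartialHomeomorph M (Model n))
    (y w : Model n) : ℝ :=
  F.toFun (e.symm y) (mfderiv 𝓘(ℝ, Model n) (𝓡 n) e.symm y w)

/-- The coordinates in the chart `e` of a tangent vector `v` at `x`. -/
def vecInChart (e : OpenPartialHomeomorph M (Model n)) (x : M) (v : TangentSpace (𝓡 n) x) :
    Model n :=
  mfderiv (𝓡 n) 𝓘(ℝ, Model n) e x v

/-- The differential `Du(x)` of a function. -/
def differential (u : M → ℝ) (x : M) : TangentSpace (𝓡 n) x →L[ℝ] ℝ :=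
  mfderiv (𝓡 n) 𝓘(ℝ, ℝ) u x

/-! #### Smooth positive measures and divergence -/

/-- In the chart `e`, the measure `m` is `e^{Φ} dx¹ ⋯ dxⁿ` with `Φ` smooth. -/
def IsLogDensity [MeasurableSpace M] (m : MeasureTheory.Measure M)
    (e : OpenPartialHomeomorph M (Model n)) (Φ : Model n → ℝ) : Prop :=
  ContDiffOn ℝ ∞ Φ e.target ∧
    ∀ s : Set M, MeasurableSet s → s ⊆ e.source →
      m s = ∫⁻ y in e '' s, ENNReal.ofReal (Real.exp (Φ y))

/-- `m` is a positive `C^∞` measure. -/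
def IsSmoothPositiveMeasure (n : ℕ) {M : Type*} [TopologicalSpace M] [ChartedSpace (Model n) M]
    [MeasurableSpace M] (m : MeasureTheory.Measure M) : Prop :=
  ∀ e ∈ atlas (Model n) M, ∃ Φ : Model n → ℝ, IsLogDensity m e Φ

/-- The function `Φ` with `m = e^{Φ} dx¹ ⋯ dxⁿ` in the chart `e` (unique on `e.target`). -/
def logDensity [MeasurableSpace M] (m : MeasureTheory.Measure M)
    (e : OpenPartialHomeomorph M (Model n)) : Model n → ℝ :=
  Classical.epsilon (IsLogDensity m e)

/-- `div_m V = ∑ᵢ (∂Vⁱ/∂xⁱ + Vⁱ ∂Φ/∂xⁱ)`, at `x` in the preferred chart at `x`. -/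
def divergence [MeasurableSpace M] (m : MeasureTheory.Measure M)
    (V : (x : M) → TangentSpace (𝓡 n) x) (x : M) : ℝ :=
  let e := chartAt (Model n) x
  let W : Model n → Model n := fun y => vecInChart e (e.symm y) (V (e.symm y))
  ∑ i : Fin n, (fderiv ℝ (fun y => W y i) (e x) (basisVec i)
    + W (e x) i * fderiv ℝ (logDensity m e) (e x) (basisVec i))

/-! #### Gradient and Laplacian -/

/-- The dual norm `F*(α) = sup {α(v) : F(v) ≤ 1}`. -/
def FinslerStructure.dualNorm (F : FinslerStructure n M) (x : M)
    (α : TangentSpace (𝓡 n) x →L[ℝ] ℝ) : ℝ :=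
  sSup {r : ℝ | ∃ v : TangentSpace (𝓡 n) x, F.toFun x v ≤ 1 ∧ r = α v}

/-- The Legendre transform: the unique `v` with `F(v) = F*(α)` and `α(v) = F*(α)²`. -/
def FinslerStructure.legendre (F : FinslerStructure n M) (x : M)
    (α : TangentSpace (𝓡 n) x →L[ℝ] ℝ) : TangentSpace (𝓡 n) x :=
  Classical.epsilon fun v : TangentSpace (𝓡 n) x =>
    F.toFun x v = F.dualNorm x α ∧ α v = F.dualNorm x α ^ 2

/-- The (nonlinear) gradient vector field `∇u`. -/
def FinslerStructure.gradient (F : FinslerStructure n M) (u : M → ℝ) (x : M) :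
    TangentSpace (𝓡 n) x :=
  F.legendre x (differential u x)

/-- The (nonlinear) Laplacian `Δu = div_m(∇u)`. -/
def FinslerStructure.laplacian [MeasurableSpace M] (F : FinslerStructure n M)
    (m : MeasureTheory.Measure M) (u : M → ℝ) : M → ℝ :=
  divergence m (F.gradient u)

/-- The linearized gradient `∇^V f = ∑ g^{ij}(V) ∂f/∂xʲ ∂/∂xⁱ`, i.e. the gradient of `f` with
respect to the Riemannian metric `g_V`; at `x` in the coordinates of the preferred chart at `x`,
in which `TangentSpace (𝓡 n) x` is `ℝⁿ`. -/
def FinslerStructure.linGradient (F : FinslerStructure n M)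
    (V : (x : M) → TangentSpace (𝓡 n) x) (f : M → ℝ) (x : M) : TangentSpace (𝓡 n) x :=
  ∑ i : Fin n, (∑ j : Fin n, (gMatrix (n := n) (F.toFun x) (V x))⁻¹ i j
    * differential f x (basisVec j : Model n)) • (basisVec i : Model n)

/-- The linearized Laplacian `Δ^V f = div_m(∇^V f)`. -/
def FinslerStructure.linLaplacian [MeasurableSpace M] (F : FinslerStructure n M)
    (m : MeasureTheory.Measure M) (V : (x : M) → TangentSpace (𝓡 n) x) (f : M → ℝ) : M → ℝ :=
  divergence m (F.linGradient V f)

/-! #### Weighted Ricci curvature -/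

/-- Near `t = 0`, the curve `η` is the geodesic with initial velocity `v` at `x`: in the preferred
chart at `x` it solves the geodesic equation `η̈ⁱ + Gⁱ(η̇) = 0`. -/
structure FinslerStructure.IsGeodesicAt (F : FinslerStructure n M) (x : M)
    (v : TangentSpace (𝓡 n) x) (η : ℝ → M) : Prop where
  start : η 0 = x
  mem_source : ∀ᶠ t in nhds (0 : ℝ), η t ∈ (chartAt (Model n) x).source
  velocity : HasDerivAt (fun s => chartAt (Model n) x (η s)) (vecInChart (chartAt (Model n) x) x v) 0
  differentiable : ∀ᶠ t in nhds (0 : ℝ),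
    DifferentiableAt ℝ (fun s => chartAt (Model n) x (η s)) t
  equation : ∀ᶠ t in nhds (0 : ℝ), ∀ i : Fin n,
    HasDerivAt (fun s => deriv (fun r => chartAt (Model n) x (η r)) s i)
      (-spray (F.inChart (chartAt (Model n) x)) i (chartAt (Model n) x (η t))
        (deriv (fun r => chartAt (Model n) x (η r)) t)) t

/-- The geodesic `η` with `η̇(0) = v` (its germ at `0` is unique for `v ≠ 0`). -/
def FinslerStructure.geodesic (F : FinslerStructure n M) (x : M) (v : TangentSpace (𝓡 n) x) :
    ℝ → M :=
  haveI : Nonempty M := ⟨x⟩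
  Classical.epsilon (F.IsGeodesicAt x v)

/-- The Ricci curvature `Ric(v)` of `F`, for `v ≠ 0`. -/
def FinslerStructure.ricci (F : FinslerStructure n M) (x : M) (v : TangentSpace (𝓡 n) x) : ℝ :=
  ricciCoord (F.inChart (chartAt (Model n) x)) (chartAt (Model n) x x)
    (vecInChart (chartAt (Model n) x) x v)

/-- `Ψ ∘ η` for a curve `η` in the chart domain at `x`, where `m = e^{-Ψ} vol_{g_V}` and `V` is a
vector field extending the velocity of `η`, i.e. `V(η(t)) = η̇(t)`. -/
def FinslerStructure.weightAlong [MeasurableSpace M] (F : FinslerStructure n M)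
    (m : MeasureTheory.Measure M) (x : M) (η : ℝ → M) (t : ℝ) : ℝ :=
  weightCoord (F.inChart (chartAt (Model n) x)) (logDensity m (chartAt (Model n) x))
    (chartAt (Model n) x (η t)) (deriv (fun s => chartAt (Model n) x (η s)) t)

/-- The weighted Ricci curvature `Ric_∞(v) = Ric(v) + (Ψ ∘ η)''(0)`, with `η` the geodesic with
`η̇(0) = v`, and `Ric_∞(0) = 0`. Both terms are positively 2-homogeneous in `v`, so no
normalization `F(v) = 1` is needed. -/
def FinslerStructure.ricciInfty [MeasurableSpace M] (F : FinslerStructure n M)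
    (m : MeasureTheory.Measure M) (x : M) (v : TangentSpace (𝓡 n) x) : ℝ :=
  open Classical in
  if v = 0 then 0
  else F.ricci x v + deriv (deriv (F.weightAlong m x (F.geodesic x v))) 0

/-- The condition `Ric_∞ ≥ K`. -/
def FinslerStructure.RicciInftyGE [MeasurableSpace M] (F : FinslerStructure n M)
    (m : MeasureTheory.Measure M) (K : ℝ) : Prop :=
  ∀ (x : M) (v : TangentSpace (𝓡 n) x), K * F.toFun x v ^ 2 ≤ F.ricciInfty m x v

end Manifold

end Finsler

end

/-!
In a chart, `W = ∇u` is a smooth field where `Du ≠ 0`, since the Legendre transform is a local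
diffeomorphism there. The acceleration `Wⁱ_{|j} Wʲ` of `W` is `∇^W (F²(W)/2)`, because the covariant
derivative `∂ⱼWⁱ + Nⁱⱼ(W)` is self-adjoint for `g_W`: this is the symmetry of the second derivatives
of `u`. Subtracting `D(div W)(W)` from the divergence of the acceleration leaves the trace of
the square of this covariant derivative plus the curvature term `Ric_∞(W)`, a direct computation
in which the third derivatives of `u` cancel. The trace is the squared Hilbert–Schmidt norm of a
self-adjoint matrix, and it dominates `D[F(W)](∇^W[F(W)])`, the squared length of its value
on the unit vector `W / F(W)`, by Cauchy–Schwarz.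
-/

noncomputable section

namespace Finsler

open scoped Topology

section Calculus

variable {X G : Type*} [NormedAddCommGroup X] [NormedSpace ℝ X] [NormedAddCommGroup G]
  [NormedSpace ℝ G]

theorem fderiv_fderiv_apply_comm {f : X → G} {p : X} (hf : ContDiffAt ℝ 2 f p) (a b : X) :
    fderiv ℝ (fun q => fderiv ℝ f q a) p b = fderiv ℝ (fun q => fderiv ℝ f q b) p a := by
  have hd : DifferentiableAt ℝ (fderiv ℝ f) p :=
    (hf.fderiv_right (m := 1) (by norm_num)).differentiableAt one_ne_zero
  have hsymm : IsSymmSndFDerivAt ℝ f p := hf.isSymmSndFDerivAt (by simp)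
  rw [fderiv_clm_apply hd (differentiableAt_const a),
    fderiv_clm_apply hd (differentiableAt_const b)]
  simpa using hsymm b a

theorem fderiv_apply_self_of_homogeneous {f : X → G} {v : X} (k : ℕ)
    (hf : DifferentiableAt ℝ f v) (hom : ∀ c : ℝ, 0 < c → f (c • v) = c ^ k • f v) :
    fderiv ℝ f v v = (k : ℝ) • f v := by
  have hray : HasDerivAt (fun t : ℝ => t • v) v 1 := by
    simpa using (hasDerivAt_id (1 : ℝ)).smul_const v
  have hchain : HasDerivAt (fun t : ℝ => f (t • v)) (fderiv ℝ f v v) 1 :=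
    HasFDerivAt.comp_hasDerivAt 1 (by simpa using hf.hasFDerivAt) hray
  have hpow : HasDerivAt (fun t : ℝ => t ^ k • f v) ((k : ℝ) • f v) 1 := by
    simpa using (hasDerivAt_pow k (1 : ℝ)).smul_const (f v)
  refine hchain.unique (hpow.congr_of_eventuallyEq ?_)
  filter_upwards [Ioi_mem_nhds one_pos] with t ht using hom t ht

theorem fderiv_smul_of_homogeneous {f : X → G} {c : ℝ} (hc : c ≠ 0) (k : ℕ)
    (hom : ∀ v, f (c • v) = c ^ (k + 1) • f v) (v : X) :
    fderiv ℝ f (c • v) = c ^ k • fderiv ℝ f v := by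
  have h : c • fderiv ℝ f (c • v) = c • c ^ k • fderiv ℝ f v := by
    rw [← fderiv_comp_smul, funext hom, smul_smul, ← pow_succ']
    exact congrFun (fderiv_const_smul_field (𝕜 := ℝ) (f := f) (c ^ (k + 1))) v
  exact smul_right_injective _ hc h

theorem contDiffAt_matrix_det {ι : Type*} [Fintype ι] [DecidableEq ι] {k : ℕ∞ω}
    {A : X → Matrix ι ι ℝ} {p : X} (hA : ∀ i j, ContDiffAt ℝ k (fun q => A q i j) p) :
    ContDiffAt ℝ k (fun q => (A q).det) p := by
  simp_rw [Matrix.det_apply']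
  exact ContDiffAt.sum fun σ _ => contDiffAt_const.mul (contDiffAt_prod fun i _ => hA _ _)

theorem contDiffAt_matrix_inv {ι : Type*} [Fintype ι] [DecidableEq ι] {k : ℕ∞ω}
    {A : X → Matrix ι ι ℝ} {p : X} (hA : ∀ i j, ContDiffAt ℝ k (fun q => A q i j) p)
    (h0 : (A p).det ≠ 0) (i j : ι) : ContDiffAt ℝ k (fun q => (A q)⁻¹ i j) p := by
  have hadj : ContDiffAt ℝ k (fun q => (A q).adjugate i j) p := by
    simp_rw [Matrix.adjugate_apply]
    refine contDiffAt_matrix_det fun k l => ?_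
    simp_rw [Matrix.updateRow_apply]
    split_ifs
    exacts [contDiffAt_const, hA k l]
  simpa [Matrix.inv_def] using ((contDiffAt_matrix_det hA).inv h0).mul hadj

theorem hasFDerivAt_matrix_det {ι : Type*} [Fintype ι] [DecidableEq ι] {A : X → Matrix ι ι ℝ}
    {A' : ι → ι → X →L[ℝ] ℝ} {p : X}
    (hA : ∀ i j, HasFDerivAt (fun q => A q i j) (A' i j) p) :
    HasFDerivAt (fun q => (A q).det) (∑ i, ∑ j, (A p).adjugate j i • A' i j) p := by
  let det : ContinuousMultilinearMap ℝ (fun _ : ι => ι → ℝ) ℝ :=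
    { (Matrix.detRowAlternating (n := ι) (R := ℝ)).toMultilinearMap with
      cont := Continuous.matrix_det (A := fun M : ι → ι → ℝ => Matrix.of M) continuous_id }
  have hdet := HasFDerivAt.multilinear_comp (f := det) (g := fun i q => A q i)
    (g' := fun i => ContinuousLinearMap.pi (A' i)) (x := p) fun i => hasFDerivAt_pi.2 (hA i)
  refine hdet.congr_fderiv ?_
  ext a
  simp only [FunLike.coe_sum, Finset.sum_apply, ContinuousLinearMap.comp_apply,
    smul_apply, smul_eq_mul]
  refine Finset.sum_congr rfl fun i _ => ?_
  change ((A p).updateRow i (fun j => A' i j a)).det = _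
  rw [← Matrix.cramer_transpose_apply, Matrix.cramer_eq_adjugate_mulVec,
    ← Matrix.adjugate_transpose]
  simp [Matrix.mulVec, dotProduct]

end Calculus

/-! ### Functions of position and velocity -/

section PositionVelocity

variable {n : ℕ}

theorem basisVec_apply (i j : Fin n) : (basisVec i : Model n) j = if j = i then 1 else 0 := by
  simp [basisVec]

theorem sum_coord_smul_basisVec (a : Model n) : ∑ i, a i • (basisVec i : Model n) = a := by
  ext j
  simp [basisVec_apply]

theorem map_eq_sum_basisVec {G : Type*} [NormedAddCommGroup G] [NormedSpace ℝ G]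
    (l : Model n →L[ℝ] G) (a : Model n) : l a = ∑ i, a i • l (basisVec i) := by
  conv_lhs => rw [← sum_coord_smul_basisVec a]
  simp

/-- `H` is smooth, jointly in position and velocity, near `(x, v)`. -/
def SmoothAt (H : Model n → Model n → ℝ) (x v : Model n) : Prop :=
  ContDiffAt ℝ ∞ (Function.uncurry H) (x, v)

variable {ι : Type*} {s : Finset ι} {H H' : Model n → Model n → ℝ}
  {K : ι → Model n → Model n → ℝ} {x v : Model n}

theorem pdx_eq_fderiv_uncurry (hH : DifferentiableAt ℝ (Function.uncurry H) (x, v)) (i : Fin n) :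
    pdx i H x v = fderiv ℝ (Function.uncurry H) (x, v) (basisVec i, 0) := by
  have h : HasFDerivAt (fun y => H y v) _ x :=
    HasFDerivAt.comp (f := fun y => (y, v)) x hH.hasFDerivAt (hasFDerivAt_prodMk_left x v)
  simp [pdx, h.fderiv]

theorem pdv_eq_fderiv_uncurry (hH : DifferentiableAt ℝ (Function.uncurry H) (x, v)) (i : Fin n) :
    pdv i H x v = fderiv ℝ (Function.uncurry H) (x, v) (0, basisVec i) := by
  have h : HasFDerivAt (fun w => H x w) _ v :=
    hH.hasFDerivAt.comp v (hasFDerivAt_prodMk_right x v)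
  simp [pdv, h.fderiv]

theorem fderiv_uncurry_apply (hH : DifferentiableAt ℝ (Function.uncurry H) (x, v))
    (a b : Model n) : fderiv ℝ (Function.uncurry H) (x, v) (a, b) =
      ∑ i, a i * pdx i H x v + ∑ i, b i * pdv i H x v := by
  have hx := map_eq_sum_basisVec
    ((fderiv ℝ (Function.uncurry H) (x, v)).comp (.inl ℝ (Model n) (Model n))) a
  have hv := map_eq_sum_basisVec
    ((fderiv ℝ (Function.uncurry H) (x, v)).comp (.inr ℝ (Model n) (Model n))) b
  simp only [ContinuousLinearMap.comp_apply, ContinuousLinearMap.inl_apply,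
    ContinuousLinearMap.inr_apply, smul_eq_mul] at hx hv
  simp only [pdx_eq_fderiv_uncurry hH, pdv_eq_fderiv_uncurry hH, ← hx, ← hv, ← map_add,
    Prod.mk_add_mk, add_zero, zero_add]

theorem pdx_congr (h : Function.uncurry H =ᶠ[𝓝 (x, v)] Function.uncurry H') (i : Fin n) :
    pdx i H x v = pdx i H' x v := by
  have hcont : ContinuousAt (fun y : Model n => (y, v)) x := by fun_prop
  have : (fun y => H y v) =ᶠ[𝓝 x] fun y => H' y v := hcont.eventually h
  simp only [pdx, this.fderiv_eq]

theorem pdv_congr (h : Function.uncurry H =ᶠ[𝓝 (x, v)] Function.uncurry H') (i : Fin n) :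
    pdv i H x v = pdv i H' x v := by
  have hcont : ContinuousAt (fun w : Model n => (x, w)) v := by fun_prop
  have : (fun w => H x w) =ᶠ[𝓝 v] fun w => H' x w := hcont.eventually h
  simp only [pdv, this.fderiv_eq]

theorem pdx_const_mul (i : Fin n) (c : ℝ) : pdx i (fun x v => c * H x v) x v = c * pdx i H x v :=
  congrArg (fun l => l x (basisVec i)) (fderiv_const_smul_field (𝕜 := ℝ) (f := fun y => H y v) c)

theorem pdv_const_mul (i : Fin n) (c : ℝ) : pdv i (fun x v => c * H x v) x v = c * pdv i H x v :=
  congrArg (fun l => l v (basisVec i)) (fderiv_const_smul_field (𝕜 := ℝ) (f := fun w => H x w) c)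

theorem pdx_coord (i j : Fin n) : pdx i (fun _ v : Model n => v j) x v = 0 := by
  simp [pdx]

theorem pdv_coord (i j : Fin n) :
    pdv i (fun _ v : Model n => v j) x v = if j = i then 1 else 0 := by
  have : HasFDerivAt (fun w : Model n => w j) (EuclideanSpace.proj j : Model n →L[ℝ] ℝ) v :=
    (EuclideanSpace.proj j : Model n →L[ℝ] ℝ).hasFDerivAt
  simp [pdv, this.fderiv, basisVec_apply]

namespace SmoothAt

theorem differentiableAt (hH : SmoothAt H x v) :
    DifferentiableAt ℝ (Function.uncurry H) (x, v) :=
  ContDiffAt.differentiableAt hH (by simp)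

theorem differentiableAt_fst (hH : SmoothAt H x v) : DifferentiableAt ℝ (fun y => H y v) x :=
  DifferentiableAt.comp (f := fun y => (y, v)) x hH.differentiableAt (by fun_prop)

theorem differentiableAt_snd (hH : SmoothAt H x v) : DifferentiableAt ℝ (fun w => H x w) v :=
  DifferentiableAt.comp (g := Function.uncurry H) v hH.differentiableAt (by fun_prop)

theorem eventually_differentiableAt (hH : SmoothAt H x v) :
    ∀ᶠ q in 𝓝 (x, v), DifferentiableAt ℝ (Function.uncurry H) q := by
  have h1 : ContDiffAt ℝ 1 (Function.uncurry H) (x, v) :=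
    ContDiffAt.of_le hH (by simp)
  filter_upwards [h1.eventually (by simp)] with q hq using hq.differentiableAt one_ne_zero

theorem uncurry_pdx_eventuallyEq (hH : SmoothAt H x v) (i : Fin n) :
    Function.uncurry (pdx i H) =ᶠ[𝓝 (x, v)]
      fun q => fderiv ℝ (Function.uncurry H) q (basisVec i, 0) := by
  filter_upwards [hH.eventually_differentiableAt] with q hq using pdx_eq_fderiv_uncurry hq i

theorem uncurry_pdv_eventuallyEq (hH : SmoothAt H x v) (i : Fin n) :
    Function.uncurry (pdv i H) =ᶠ[𝓝 (x, v)]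
      fun q => fderiv ℝ (Function.uncurry H) q (0, basisVec i) := by
  filter_upwards [hH.eventually_differentiableAt] with q hq using pdv_eq_fderiv_uncurry hq i

theorem fderiv_apply (hH : SmoothAt H x v) (a : Model n × Model n) :
    ContDiffAt ℝ ∞ (fun q => fderiv ℝ (Function.uncurry H) q a) (x, v) :=
  (ContDiffAt.fderiv_right hH (by simp)).clm_apply contDiffAt_const

theorem pdx (hH : SmoothAt H x v) (i : Fin n) : SmoothAt (pdx i H) x v :=
  (hH.fderiv_apply _).congr_of_eventuallyEq (hH.uncurry_pdx_eventuallyEq i)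

theorem pdv (hH : SmoothAt H x v) (i : Fin n) : SmoothAt (pdv i H) x v :=
  (hH.fderiv_apply _).congr_of_eventuallyEq (hH.uncurry_pdv_eventuallyEq i)

theorem sub (hH : SmoothAt H x v) (hH' : SmoothAt H' x v) :
    SmoothAt (fun x v => H x v - H' x v) x v := ContDiffAt.sub hH hH'

theorem add (hH : SmoothAt H x v) (hH' : SmoothAt H' x v) :
    SmoothAt (fun x v => H x v + H' x v) x v := ContDiffAt.add hH hH'

theorem mul (hH : SmoothAt H x v) (hH' : SmoothAt H' x v) :
    SmoothAt (fun x v => H x v * H' x v) x v := ContDiffAt.mul hH hH'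

theorem const (c : ℝ) : SmoothAt (fun _ _ => c) x v := contDiffAt_const

theorem sum (hK : ∀ i ∈ s, SmoothAt (K i) x v) : SmoothAt (fun x v => ∑ i ∈ s, K i x v) x v :=
  ContDiffAt.sum hK

theorem coord (j : Fin n) : SmoothAt (fun _ v => v j) x v :=
  ((EuclideanSpace.proj j : Model n →L[ℝ] ℝ).contDiff.comp contDiff_snd).contDiffAt

end SmoothAt

theorem smoothAt_of_contDiffAt {φ : Model n → ℝ} (hφ : ContDiffAt ℝ ∞ φ x) :
    SmoothAt (fun x _ => φ x) x v :=
  ContDiffAt.comp (x, v) hφ contDiffAt_fst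

theorem pdx_sub (hH : SmoothAt H x v) (hH' : SmoothAt H' x v) (i : Fin n) :
    pdx i (fun x v => H x v - H' x v) x v = pdx i H x v - pdx i H' x v := by
  simp [pdx, fderiv_fun_sub hH.differentiableAt_fst hH'.differentiableAt_fst]

theorem pdv_sub (hH : SmoothAt H x v) (hH' : SmoothAt H' x v) (i : Fin n) :
    pdv i (fun x v => H x v - H' x v) x v = pdv i H x v - pdv i H' x v := by
  simp [pdv, fderiv_fun_sub hH.differentiableAt_snd hH'.differentiableAt_snd]

theorem pdx_mul (hH : SmoothAt H x v) (hH' : SmoothAt H' x v) (i : Fin n) :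
    pdx i (fun x v => H x v * H' x v) x v = pdx i H x v * H' x v + H x v * pdx i H' x v := by
  simp only [pdx, fderiv_fun_mul hH.differentiableAt_fst hH'.differentiableAt_fst, add_apply,
    smul_apply, smul_eq_mul]
  ring

theorem pdv_mul (hH : SmoothAt H x v) (hH' : SmoothAt H' x v) (i : Fin n) :
    pdv i (fun x v => H x v * H' x v) x v = pdv i H x v * H' x v + H x v * pdv i H' x v := by
  simp only [pdv, fderiv_fun_mul hH.differentiableAt_snd hH'.differentiableAt_snd, add_apply,
    smul_apply, smul_eq_mul]
  ring

theorem pdx_sum (hK : ∀ j ∈ s, SmoothAt (K j) x v) (i : Fin n) :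
    pdx i (fun x v => ∑ j ∈ s, K j x v) x v = ∑ j ∈ s, pdx i (K j) x v := by
  simp [pdx, fderiv_fun_sum fun j hj => (hK j hj).differentiableAt_fst]

theorem pdv_sum (hK : ∀ j ∈ s, SmoothAt (K j) x v) (i : Fin n) :
    pdv i (fun x v => ∑ j ∈ s, K j x v) x v = ∑ j ∈ s, pdv i (K j) x v := by
  simp [pdv, fderiv_fun_sum fun j hj => (hK j hj).differentiableAt_snd]

theorem pdx_sum_coord_mul {K : Fin n → Model n → Model n → ℝ} (hK : ∀ j, SmoothAt (K j) x v)
    (i : Fin n) : pdx i (fun x v => ∑ j, v j * K j x v) x v = ∑ j, v j * pdx i (K j) x v := by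
  rw [pdx_sum fun j _ => (SmoothAt.coord j).mul (hK j)]
  simp_rw [pdx_mul (SmoothAt.coord _) (hK _), pdx_coord, zero_mul, zero_add]

theorem pdv_sum_coord_mul {K : Fin n → Model n → Model n → ℝ} (hK : ∀ j, SmoothAt (K j) x v)
    (i : Fin n) :
    pdv i (fun x v => ∑ j, v j * K j x v) x v = K i x v + ∑ j, v j * pdv i (K j) x v := by
  rw [pdv_sum fun j _ => (SmoothAt.coord j).mul (hK j)]
  simp_rw [pdv_mul (SmoothAt.coord _) (hK _), pdv_coord, Finset.sum_add_distrib]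
  simp

theorem sum_coord_mul_pdv_of_homogeneous (k : ℕ) (hH : SmoothAt H x v)
    (hom : ∀ c : ℝ, 0 < c → H x (c • v) = c ^ k * H x v) :
    ∑ j, v j * pdv j H x v = k * H x v := by
  have euler := fderiv_apply_self_of_homogeneous k hH.differentiableAt_snd hom
  rwa [map_eq_sum_basisVec] at euler

theorem fderiv_uncurry_fderiv_uncurry_comm (hH : SmoothAt H x v) (a b : Model n × Model n) :
    fderiv ℝ (fun q => fderiv ℝ (Function.uncurry H) q a) (x, v) b =
      fderiv ℝ (fun q => fderiv ℝ (Function.uncurry H) q b) (x, v) a :=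
  fderiv_fderiv_apply_comm (ContDiffAt.of_le hH (WithTop.coe_le_coe.mpr le_top)) a b

theorem pdv_pdv_comm (hH : SmoothAt H x v) (i j : Fin n) :
    pdv i (pdv j H) x v = pdv j (pdv i H) x v := by
  rw [pdv_eq_fderiv_uncurry (hH.pdv j).differentiableAt,
    pdv_eq_fderiv_uncurry (hH.pdv i).differentiableAt,
    (hH.uncurry_pdv_eventuallyEq i).fderiv_eq, (hH.uncurry_pdv_eventuallyEq j).fderiv_eq,
    fderiv_uncurry_fderiv_uncurry_comm hH]

theorem pdv_pdx_comm (hH : SmoothAt H x v) (i j : Fin n) :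
    pdv i (pdx j H) x v = pdx j (pdv i H) x v := by
  rw [pdv_eq_fderiv_uncurry (hH.pdx j).differentiableAt,
    pdx_eq_fderiv_uncurry (hH.pdv i).differentiableAt,
    (hH.uncurry_pdx_eventuallyEq j).fderiv_eq, (hH.uncurry_pdv_eventuallyEq i).fderiv_eq,
    fderiv_uncurry_fderiv_uncurry_comm hH]

end PositionVelocity

/-! ### Positive definite matrices -/

section LinearAlgebra

open Matrix

variable {ι : Type*} [Fintype ι]

theorem dotProduct_mulVec_self_le_trace {A : Matrix ι ι ℝ} (hA : Aᵀ = A) (w : ι → ℝ) :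
    (A *ᵥ w) ⬝ᵥ (A *ᵥ w) ≤ (A * A).trace * (w ⬝ᵥ w) := by
  have htrace : (A * Aᵀ).trace = ∑ i, A.row i ⬝ᵥ A.row i := rfl
  rw [hA] at htrace
  rw [htrace, Finset.sum_mul]
  refine Finset.sum_le_sum fun i _ => ?_
  simpa [Matrix.mulVec, dotProduct, sq] using
    Finset.sum_mul_sq_le_sq_mul_sq Finset.univ (A.row i) w

open scoped MatrixOrder Matrix.Norms.L2Operator in
theorem exists_transpose_mul_self_eq [DecidableEq ι] {G : Matrix ι ι ℝ} (hG : G.PosDef) :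
    ∃ B : Matrix ι ι ℝ, IsUnit B.det ∧ Bᵀ * B = G := by
  obtain ⟨B, hB⟩ := CStarAlgebra.nonneg_iff_eq_star_mul_self.mp hG.posSemidef.nonneg
  rw [Matrix.star_eq_conjTranspose, Matrix.conjTranspose_eq_transpose_of_trivial] at hB
  exact ⟨B, B.isUnit_iff_isUnit_det.1 (isUnit_of_mul_isUnit_right (hB ▸ hG.isUnit)), hB.symm⟩

/-- Writing `G = Bᵀ B`, conjugation by `B` turns `A` into a symmetric matrix. -/
theorem mulVec_dotProduct_le_trace {G A : Matrix ι ι ℝ} (hG : G.PosDef)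
    (hA : (G * A)ᵀ = G * A) (w : ι → ℝ) :
    (A *ᵥ w) ⬝ᵥ (G *ᵥ (A *ᵥ w)) ≤ (A * A).trace * (w ⬝ᵥ (G *ᵥ w)) := by
  classical
  obtain ⟨B, hB, rfl⟩ := exists_transpose_mul_self_eq hG
  have hform (w : ι → ℝ) : w ⬝ᵥ ((Bᵀ * B) *ᵥ w) = (B *ᵥ w) ⬝ᵥ (B *ᵥ w) := by
    rw [← Matrix.mulVec_mulVec, Matrix.dotProduct_mulVec, Matrix.vecMul_transpose]
  have hsymm : (B * A * B⁻¹)ᵀ = B * A * B⁻¹ := by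
    have hBt : B⁻¹ᵀ * Bᵀ = 1 := by
      rw [← Matrix.transpose_mul, B.mul_nonsing_inv hB, Matrix.transpose_one]
    calc (B * A * B⁻¹)ᵀ = B⁻¹ᵀ * (Bᵀ * B * A)ᵀ * B⁻¹ := by
          simp only [Matrix.transpose_mul, Matrix.transpose_transpose, Matrix.mul_assoc,
            B.mul_nonsing_inv hB, Matrix.mul_one]
      _ = (B⁻¹ᵀ * Bᵀ) * (B * A * B⁻¹) := by rw [hA]; simp only [Matrix.mul_assoc]
      _ = B * A * B⁻¹ := by rw [hBt, Matrix.one_mul]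
  have htrace : ((B * A * B⁻¹) * (B * A * B⁻¹)).trace = (A * A).trace := by
    have : (B * A * B⁻¹) * (B * A * B⁻¹) = B * (A * A) * B⁻¹ := by
      simp only [Matrix.mul_assoc, B.nonsing_inv_mul_cancel_left _ hB]
    rw [this, Matrix.trace_mul_comm, B.nonsing_inv_mul_cancel_left _ hB]
  have hvec : (B * A * B⁻¹) *ᵥ (B *ᵥ w) = B *ᵥ (A *ᵥ w) := by
    rw [Matrix.mulVec_mulVec, Matrix.mul_assoc, B.nonsing_inv_mul hB, Matrix.mul_one,
      Matrix.mulVec_mulVec]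
  rw [hform, hform, ← hvec, ← htrace]
  exact dotProduct_mulVec_self_le_trace hsymm (B *ᵥ w)

end LinearAlgebra

/-! ### Minkowski norms -/

section MinkowskiNorm

variable {n : ℕ}

/-- A smooth, strongly convex, not necessarily reversible norm on `ℝⁿ`: the restriction of a Finsler
structure to one tangent space. -/
structure IsMinkowskiNorm (f : Model n → ℝ) : Prop where
  nonneg : ∀ v, 0 ≤ f v
  contDiffOn : ContDiffOn ℝ ∞ f {0}ᶜ
  homogeneous : ∀ (v : Model n) (c : ℝ), 0 ≤ c → f (c • v) = c * f v
  halfHess_pos : ∀ v w, v ≠ 0 → w ≠ 0 → 0 < halfHess f v w w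

/-- The differential of `f² / 2`, that is, the inverse Legendre transform. -/
def momentum (f : Model n → ℝ) (v : Model n) : Model n →L[ℝ] ℝ :=
  (1 / 2 : ℝ) • fderiv ℝ (fun z => f z ^ 2) v

theorem halfHess_eq_fderiv_momentum (f : Model n → ℝ) (v a b : Model n) :
    halfHess f v a b = fderiv ℝ (fun w => momentum f w b) v a :=
  (congrArg (fun l => l v a) (fderiv_const_smul_field (𝕜 := ℝ)
    (f := fun w => fderiv ℝ (fun z => f z ^ 2) w b) (1 / 2 : ℝ))).symm

theorem momentum_comp (f : Model n → ℝ) (L : Model n ≃L[ℝ] Model n) (v a : Model n) :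
    momentum (fun w => f (L w)) v a = momentum f (L v) (L a) :=
  congrArg (fun l => (1 / 2 : ℝ) • l a) (L.comp_right_fderiv (f := fun z => f z ^ 2) (x := v))

theorem halfHess_comp (f : Model n → ℝ) (L : Model n ≃L[ℝ] Model n) (v a b : Model n) :
    halfHess (fun w => f (L w)) v a b = halfHess f (L v) (L a) (L b) := by
  simp only [halfHess_eq_fderiv_momentum, momentum_comp]
  exact congrArg (fun l => l a)
    (L.comp_right_fderiv (f := fun z => momentum f z (L b)) (x := v))

namespace IsMinkowskiNorm

variable {f : Model n → ℝ} {v w : Model n}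

theorem map_zero (hf : IsMinkowskiNorm f) : f 0 = 0 := by simpa using hf.homogeneous 0 0 le_rfl

theorem comp (hf : IsMinkowskiNorm f) (L : Model n ≃L[ℝ] Model n) :
    IsMinkowskiNorm fun w => f (L w) where
  nonneg v := hf.nonneg _
  contDiffOn := hf.contDiffOn.comp L.contDiff.contDiffOn fun v hv => by simpa using hv
  homogeneous v c hc := by simp [hf.homogeneous _ c hc]
  halfHess_pos v w hv hw := by
    rw [halfHess_comp]
    exact hf.halfHess_pos _ _ (by simpa using hv) (by simpa using hw)

theorem contDiffAt (hf : IsMinkowskiNorm f) (hv : v ≠ 0) : ContDiffAt ℝ ∞ f v :=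
  hf.contDiffOn.contDiffAt (isOpen_compl_singleton.mem_nhds hv)

theorem contDiffAt_momentum (hf : IsMinkowskiNorm f) (hv : v ≠ 0) :
    ContDiffAt ℝ ∞ (momentum f) v :=
  (((hf.contDiffAt hv).pow 2).fderiv_right (by simp)).const_smul (1 / 2 : ℝ)

theorem differentiableAt (hf : IsMinkowskiNorm f) (hv : v ≠ 0) : DifferentiableAt ℝ f v :=
  (hf.contDiffAt hv).differentiableAt (by simp)

theorem differentiableAt_momentum (hf : IsMinkowskiNorm f) (hv : v ≠ 0) :
    DifferentiableAt ℝ (momentum f) v :=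
  (hf.contDiffAt_momentum hv).differentiableAt (by simp)

theorem momentum_eq (hf : IsMinkowskiNorm f) (hv : v ≠ 0) :
    momentum f v = f v • fderiv ℝ f v := by
  have h : HasFDerivAt (fun z => f z ^ 2) _ v := (hf.differentiableAt hv).hasFDerivAt.pow 2
  rw [momentum, h.fderiv, smul_smul]
  congr 1
  simp

theorem fderiv_self (hf : IsMinkowskiNorm f) (hv : v ≠ 0) : fderiv ℝ f v v = f v := by
  simpa using fderiv_apply_self_of_homogeneous 1 (hf.differentiableAt hv)
    fun c hc => by simpa using hf.homogeneous v c hc.le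

theorem momentum_self (hf : IsMinkowskiNorm f) (hv : v ≠ 0) : momentum f v v = f v ^ 2 := by
  rw [hf.momentum_eq hv, smul_apply, hf.fderiv_self hv, smul_eq_mul, sq]

theorem halfHess_smul (hf : IsMinkowskiNorm f) {c : ℝ} (hc : 0 < c) (v a b : Model n) :
    halfHess f (c • v) a b = halfHess f v a b := by
  have hfst (w : Model n) := fderiv_smul_of_homogeneous (f := fun z => f z ^ 2) hc.ne' 1
    (fun z => by simp [hf.homogeneous z c hc.le, mul_pow]) w
  have hsnd := fderiv_smul_of_homogeneous (f := fun w => fderiv ℝ (fun z => f z ^ 2) w b) hc.ne' 0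
    (fun w => by simp [hfst]) v
  simp [halfHess, hsnd]

theorem halfHess_eq (hf : IsMinkowskiNorm f) (hv : v ≠ 0) (a b : Model n) :
    halfHess f v a b = fderiv ℝ (momentum f) v a b := by
  rw [halfHess_eq_fderiv_momentum, fderiv_clm_apply (hf.differentiableAt_momentum hv)
    (differentiableAt_const b)]
  simp

theorem halfHess_symm (hf : IsMinkowskiNorm f) (hv : v ≠ 0) (a b : Model n) :
    halfHess f v a b = halfHess f v b a :=
  congrArg ((1 / 2 : ℝ) * ·) (fderiv_fderiv_apply_comm
    (((hf.contDiffAt hv).pow 2).of_le (WithTop.coe_le_coe.mpr le_top)) b a)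

theorem halfHess_self_right (hf : IsMinkowskiNorm f) (hv : v ≠ 0) (a : Model n) :
    halfHess f v a v = momentum f v a := by
  have hsq : (fun w => momentum f w w) =ᶠ[𝓝 v] fun w => f w ^ 2 := by
    filter_upwards [isOpen_compl_singleton.mem_nhds hv] with w hw using hf.momentum_self hw
  have hderiv : halfHess f v a v + momentum f v a = 2 * momentum f v a := by
    have h := DFunLike.congr_fun (hsq.fderiv_eq (𝕜 := ℝ)) a
    rw [fderiv_clm_apply (hf.differentiableAt_momentum hv) differentiableAt_fun_id] at h
    rw [hf.halfHess_eq hv]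
    simpa [momentum, add_comm] using h
  linarith

theorem halfHess_self_left (hf : IsMinkowskiNorm f) (hv : v ≠ 0) (a : Model n) :
    halfHess f v v a = momentum f v a := by
  rw [hf.halfHess_symm hv, hf.halfHess_self_right hv]

theorem pos (hf : IsMinkowskiNorm f) (hv : v ≠ 0) : 0 < f v := by
  have := hf.halfHess_pos v v hv hv
  rw [hf.halfHess_self_right hv, hf.momentum_self hv] at this
  exact (hf.nonneg v).lt_of_ne fun h => by simp [← h] at this

theorem momentum_self_pos (hf : IsMinkowskiNorm f) (hv : v ≠ 0) : 0 < momentum f v v := by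
  rw [hf.momentum_self hv]
  exact pow_pos (hf.pos hv) 2

theorem halfHess_eq_sum (hf : IsMinkowskiNorm f) (hv : v ≠ 0) (a b : Model n) :
    halfHess f v a b = ∑ i, a i * ∑ j, gMatrix f v i j * b j := by
  have ha := map_eq_sum_basisVec ((fderiv ℝ (momentum f) v).flip b) a
  simp only [ContinuousLinearMap.flip_apply, smul_eq_mul] at ha
  rw [hf.halfHess_eq hv, ha]
  refine Finset.sum_congr rfl fun i _ => ?_
  rw [map_eq_sum_basisVec (fderiv ℝ (momentum f) v (basisVec i)) b]
  simp [gMatrix, hf.halfHess_eq hv, mul_comm]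

open Matrix in
theorem halfHess_eq_dotProduct (hf : IsMinkowskiNorm f) (hv : v ≠ 0) (a b : Model n) :
    halfHess f v a b = a.ofLp ⬝ᵥ (gMatrix f v *ᵥ b.ofLp) := hf.halfHess_eq_sum hv a b

theorem gMatrix_symm (hf : IsMinkowskiNorm f) (hv : v ≠ 0) (i j : Fin n) :
    gMatrix f v i j = gMatrix f v j i :=
  hf.halfHess_symm hv _ _

theorem gMatrix_posDef (hf : IsMinkowskiNorm f) (hv : v ≠ 0) : (gMatrix f v).PosDef := by
  refine .of_dotProduct_mulVec_pos (Matrix.IsHermitian.ext fun i j => hf.gMatrix_symm hv j i)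
    fun w hw => ?_
  have hw' : WithLp.toLp 2 w ≠ (0 : Model n) := by simpa using hw
  simpa [hf.halfHess_eq_dotProduct hv] using hf.halfHess_pos v (WithLp.toLp 2 w) hv hw'

theorem eq_of_halfHess_eq (hf : IsMinkowskiNorm f) (hv : v ≠ 0) {a a' : Model n}
    (h : ∀ b, halfHess f v a b = halfHess f v a' b) : a = a' := by
  by_contra hne
  have hzero : halfHess f v (a - a') (a - a') = 0 := by
    simpa [hf.halfHess_eq hv, sub_eq_zero] using h (a - a')
  exact (hf.halfHess_pos v _ hv (sub_ne_zero.2 hne)).ne' hzero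

theorem strictMonoOn_momentum (hf : IsMinkowskiNorm f) (hvw : v ≠ w)
    (hseg : ∀ t ∈ Set.Icc (0 : ℝ) 1, v + t • (w - v) ≠ 0) :
    StrictMonoOn (fun t : ℝ => momentum f (v + t • (w - v)) (w - v)) (Set.Icc 0 1) := by
  have hder : ∀ t ∈ Set.Icc (0 : ℝ) 1, HasDerivAt
      (fun t : ℝ => momentum f (v + t • (w - v)) (w - v))
      (halfHess f (v + t • (w - v)) (w - v) (w - v)) t := by
    intro t ht
    have hline : HasDerivAt (fun t : ℝ => v + t • (w - v)) (w - v) t := by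
      simpa using ((hasDerivAt_id t).smul_const (w - v)).const_add v
    have hcomp := (hf.differentiableAt_momentum (hseg t ht)).hasFDerivAt.comp_hasDerivAt t hline
    rw [hf.halfHess_eq (hseg t ht)]
    simpa using hcomp.clm_apply (hasDerivAt_const t (w - v))
  refine strictMonoOn_of_deriv_pos (convex_Icc 0 1)
    (fun t ht => (hder t ht).continuousAt.continuousWithinAt) fun t ht => ?_
  have ht' := interior_subset ht
  rw [(hder t ht').deriv]
  exact hf.halfHess_pos _ _ (hseg t ht') (sub_ne_zero.2 hvw.symm)

theorem momentum_injective (hf : IsMinkowskiNorm f) (hv : v ≠ 0) (hw : w ≠ 0)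
    (h : momentum f v = momentum f w) : v = w := by
  by_contra hne
  have hvpos : 0 < momentum f v v := hf.momentum_self_pos hv
  have hwpos : 0 < momentum f v w := h ▸ hf.momentum_self_pos hw
  have hseg : ∀ t ∈ Set.Icc (0 : ℝ) 1, v + t • (w - v) ≠ 0 := by
    intro t ht h0
    have hpos : 0 < momentum f v (v + t • (w - v)) :=
      (convex_halfSpace_gt (momentum f v).toLinearMap.isLinear 0).add_smul_sub_mem hvpos hwpos ht
    simp [h0] at hpos
  have hlt := hf.strictMonoOn_momentum hne hseg (by simp) (by simp) zero_lt_one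
  simp [h] at hlt

theorem exists_forall_div_le_div (hf : IsMinkowskiNorm f) (α : Model n →L[ℝ] ℝ) {a : Model n}
    (ha : a ≠ 0) : ∃ b ≠ 0, ∀ w ≠ 0, α w / f w ≤ α b / f b := by
  have hne : ∀ v ∈ Metric.sphere (0 : Model n) 1, v ≠ 0 := fun v hv h => by simp [h] at hv
  have hunit (v : Model n) (hv : v ≠ 0) : ‖v‖⁻¹ • v ∈ Metric.sphere (0 : Model n) 1 := by
    simp [norm_smul, inv_mul_cancel₀ (norm_ne_zero_iff.2 hv)]
  obtain ⟨b, hb, hmax⟩ := (isCompact_sphere (0 : Model n) 1).exists_isMaxOn ⟨_, hunit a ha⟩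
    (α.continuous.continuousOn.div (hf.contDiffOn.continuousOn.mono hne)
      fun v hv => (hf.pos (hne v hv)).ne')
  refine ⟨b, hne b hb, fun w hw => ?_⟩
  have hscale : α (‖w‖⁻¹ • w) / f (‖w‖⁻¹ • w) = α w / f w := by
    rw [hf.homogeneous _ _ (by positivity), map_smul, smul_eq_mul,
      mul_div_mul_left _ _ (inv_ne_zero (norm_ne_zero_iff.2 hw))]
  exact hscale.symm.trans_le (hmax (hunit w hw))

theorem exists_norming_vector (hf : IsMinkowskiNorm f) {α : Model n →L[ℝ] ℝ} (hα : α ≠ 0) :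
    ∃ s > 0, ∃ v, f v = 1 ∧ α v = s ∧ ∀ w, α w ≤ s * f w := by
  obtain ⟨a, ha⟩ : ∃ a, 0 < α a := by
    obtain ⟨a, ha⟩ := DFunLike.ne_iff.1 hα
    rcases lt_or_gt_of_ne ha with h | h
    exacts [⟨-a, by simpa using h⟩, ⟨a, h⟩]
  have ha0 : a ≠ 0 := fun h => by simp [h] at ha
  obtain ⟨b, hb, hmax⟩ := hf.exists_forall_div_le_div α ha0
  refine ⟨α b / f b, (div_pos ha (hf.pos ha0)).trans_le (hmax a ha0), (f b)⁻¹ • b, ?_, ?_, ?_⟩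
  · rw [hf.homogeneous _ _ (inv_nonneg.2 (hf.nonneg b)), inv_mul_cancel₀ (hf.pos hb).ne']
  · rw [map_smul, smul_eq_mul, div_eq_inv_mul]
  · intro w
    by_cases hw : w = 0
    · simp [hw, hf.map_zero]
    · exact (div_le_iff₀ (hf.pos hw)).1 (hmax w hw)

theorem momentum_eq_of_forall_le (hf : IsMinkowskiNorm f) (hv : v ≠ 0) {α : Model n →L[ℝ] ℝ}
    (hαv : α v = f v ^ 2) (hα : ∀ w, α w ≤ f v * f w) : momentum f v = α := by
  have hmin : IsLocalMin (fun w => f v * f w - α w) v :=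
    Filter.Eventually.of_forall fun w => by
      have := hα w
      simp only [hαv]
      linarith [sq (f v)]
  have hder : HasFDerivAt (fun w => f v * f w - α w) (f v • fderiv ℝ f v - α) v :=
    ((hf.differentiableAt hv).hasFDerivAt.const_mul (f v)).sub α.hasFDerivAt
  rw [hf.momentum_eq hv]
  exact sub_eq_zero.1 (hmin.hasFDerivAt_eq_zero hder)

theorem legendre_spec (hf : IsMinkowskiNorm f) {α : Model n →L[ℝ] ℝ} (hα : α ≠ 0) {s : ℝ}
    (hs : s = sSup {r : ℝ | ∃ v : Model n, f v ≤ 1 ∧ r = α v}) :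
    (∃ v, f v = s ∧ α v = s ^ 2) ∧
      ∀ v, f v = s → α v = s ^ 2 → v ≠ 0 ∧ momentum f v = α := by
  obtain ⟨s', hs', v₀, hv₀, hαv₀, hmax⟩ := hf.exists_norming_vector hα
  have hgreatest : IsGreatest {r : ℝ | ∃ v : Model n, f v ≤ 1 ∧ r = α v} s' := by
    refine ⟨⟨v₀, hv₀.le, hαv₀.symm⟩, ?_⟩
    rintro r ⟨v, hv, rfl⟩
    exact (hmax v).trans (mul_le_of_le_one_right hs'.le hv)
  obtain rfl : s = s' := hs.trans hgreatest.csSup_eq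
  refine ⟨⟨s • v₀, ?_, ?_⟩, ?_⟩
  · rw [hf.homogeneous _ _ hs'.le, hv₀, mul_one]
  · rw [map_smul, hαv₀, smul_eq_mul, sq]
  · rintro v rfl hαv
    have hv : v ≠ 0 := fun h => hs'.ne' (by rw [h, hf.map_zero])
    exact ⟨hv, hf.momentum_eq_of_forall_le hv hαv hmax⟩

end IsMinkowskiNorm

end MinkowskiNorm

/-! ### Finsler structures in coordinates -/

section FinslerCoordinates

variable {n : ℕ}

/-- `f` is the coordinate expression of a Finsler structure over the open set `O`. -/
structure IsFinslerOn (O : Set (Model n)) (f : Model n → Model n → ℝ) : Prop where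
  isOpen : IsOpen O
  smoothAt : ∀ x ∈ O, ∀ v ≠ 0, SmoothAt f x v
  minkowski : ∀ x ∈ O, IsMinkowskiNorm (f x)

/-- The energy `f² / 2`, the Lagrangian of the geodesic flow. -/
def energy (f : Model n → Model n → ℝ) (x v : Model n) : ℝ := (1 / 2) * f x v ^ 2

/-- The components `∂(f² / 2)/∂vⁱ` of the inverse Legendre transform. -/
def covec (f : Model n → Model n → ℝ) (i : Fin n) : Model n → Model n → ℝ := pdv i (energy f)

/-- The derivative `∑ vʲ ∂H/∂xʲ - ∑ Gʲ ∂H/∂vʲ` of `H` along the geodesic flow. -/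
def sprayDeriv (f H : Model n → Model n → ℝ) (x v : Model n) : ℝ :=
  ∑ j, v j * pdx j H x v - ∑ j, spray f j x v * pdv j H x v

theorem covec_eq_momentum (f : Model n → Model n → ℝ) (i : Fin n) (x v : Model n) :
    covec f i x v = momentum (f x) v (basisVec i) :=
  pdv_const_mul (H := fun x v => f x v ^ 2) i (1 / 2)

theorem gLow_eq_pdv_covec (f : Model n → Model n → ℝ) (i j : Fin n) :
    gLow f i j = pdv i (covec f j) := by
  ext x v
  simp only [gLow, gMatrix, Matrix.of_apply, halfHess_eq_fderiv_momentum, pdv, covec_eq_momentum]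

theorem pdv_spray (f : Model n → Model n → ℝ) (i j : Fin n) (x v : Model n) :
    pdv j (spray f i) x v = 2 * nonlinConn f i j x v := by
  simp [nonlinConn]

namespace IsFinslerOn

variable {O : Set (Model n)} {f H H' : Model n → Model n → ℝ} {x v : Model n}

theorem eventually (hf : IsFinslerOn O f) (hx : x ∈ O) (hv : v ≠ 0) :
    ∀ᶠ q in 𝓝 (x, v), q.1 ∈ O ∧ q.2 ≠ 0 :=
  (hf.isOpen.prod isOpen_compl_singleton).mem_nhds ⟨hx, hv⟩

theorem pdx_congr (hf : IsFinslerOn O f) (hx : x ∈ O) (hv : v ≠ 0)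
    (h : ∀ y ∈ O, ∀ w ≠ 0, H y w = H' y w) (i : Fin n) : pdx i H x v = pdx i H' x v :=
  Finsler.pdx_congr ((hf.eventually hx hv).mono fun q hq => h q.1 hq.1 q.2 hq.2) i

theorem pdv_congr (hf : IsFinslerOn O f) (hx : x ∈ O) (hv : v ≠ 0)
    (h : ∀ y ∈ O, ∀ w ≠ 0, H y w = H' y w) (i : Fin n) : pdv i H x v = pdv i H' x v :=
  Finsler.pdv_congr ((hf.eventually hx hv).mono fun q hq => h q.1 hq.1 q.2 hq.2) i

theorem smoothAt_energy (hf : IsFinslerOn O f) (hx : x ∈ O) (hv : v ≠ 0) :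
    SmoothAt (energy f) x v :=
  (SmoothAt.const _).mul (ContDiffAt.pow (hf.smoothAt x hx v hv) 2)

theorem smoothAt_covec (hf : IsFinslerOn O f) (hx : x ∈ O) (hv : v ≠ 0) (i : Fin n) :
    SmoothAt (covec f i) x v :=
  (hf.smoothAt_energy hx hv).pdv i

theorem smoothAt_gLow (hf : IsFinslerOn O f) (hx : x ∈ O) (hv : v ≠ 0) (i j : Fin n) :
    SmoothAt (gLow f i j) x v := by
  rw [gLow_eq_pdv_covec]
  exact (hf.smoothAt_covec hx hv j).pdv i

theorem det_pos (hf : IsFinslerOn O f) (hx : x ∈ O) (hv : v ≠ 0) : 0 < (gMatrix (f x) v).det :=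
  ((hf.minkowski x hx).gMatrix_posDef hv).det_pos

theorem isUnit_det (hf : IsFinslerOn O f) (hx : x ∈ O) (hv : v ≠ 0) :
    IsUnit (gMatrix (f x) v).det :=
  isUnit_iff_ne_zero.2 (hf.det_pos hx hv).ne'

theorem smoothAt_gUp (hf : IsFinslerOn O f) (hx : x ∈ O) (hv : v ≠ 0) (i j : Fin n) :
    SmoothAt (gUp f i j) x v :=
  contDiffAt_matrix_inv (A := fun q : Model n × Model n => gMatrix (f q.1) q.2)
    (hf.smoothAt_gLow hx hv) (hf.det_pos hx hv).ne' i j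

theorem smoothAt_spray (hf : IsFinslerOn O f) (hx : x ∈ O) (hv : v ≠ 0) (i : Fin n) :
    SmoothAt (spray f i) x v := by
  have hpdx := fun i j k => (hf.smoothAt_gLow hx hv i j).pdx k
  exact SmoothAt.sum fun j _ => SmoothAt.sum fun k _ =>
    (((SmoothAt.const _).mul (SmoothAt.sum fun l _ => (hf.smoothAt_gUp hx hv i l).mul
      (((hpdx l k j).add (hpdx j l k)).sub (hpdx j k l)))).mul (SmoothAt.coord j)).mul
      (SmoothAt.coord k)

theorem smoothAt_nonlinConn (hf : IsFinslerOn O f) (hx : x ∈ O) (hv : v ≠ 0) (i j : Fin n) :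
    SmoothAt (nonlinConn f i j) x v :=
  (SmoothAt.const _).mul ((hf.smoothAt_spray hx hv i).pdv j)

theorem gLow_symm (hf : IsFinslerOn O f) (hx : x ∈ O) (hv : v ≠ 0) (i j : Fin n) :
    gLow f i j x v = gLow f j i x v :=
  (hf.minkowski x hx).gMatrix_symm hv i j

theorem pdx_gLow_symm (hf : IsFinslerOn O f) (hx : x ∈ O) (hv : v ≠ 0) (i j l : Fin n) :
    pdx i (gLow f j l) x v = pdx i (gLow f l j) x v :=
  hf.pdx_congr hx hv (fun _ hy _ hw => hf.gLow_symm hy hw j l) i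

theorem pdv_gLow_symm (hf : IsFinslerOn O f) (hx : x ∈ O) (hv : v ≠ 0) (i j l : Fin n) :
    pdv i (gLow f j l) x v = pdv i (gLow f l j) x v :=
  hf.pdv_congr hx hv (fun _ hy _ hw => hf.gLow_symm hy hw j l) i

theorem pdv_gLow_rotate (hf : IsFinslerOn O f) (hx : x ∈ O) (hv : v ≠ 0) (k m i : Fin n) :
    pdv k (gLow f m i) x v = pdv i (gLow f k m) x v := by
  rw [hf.pdv_gLow_symm hx hv, gLow_eq_pdv_covec, gLow_eq_pdv_covec,
    pdv_pdv_comm (hf.smoothAt_covec hx hv m)]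

/-! ### Homogeneity of the spray -/

theorem gMatrix_smul (hf : IsFinslerOn O f) (hx : x ∈ O) {c : ℝ} (hc : 0 < c) (v : Model n) :
    gMatrix (f x) (c • v) = gMatrix (f x) v := by
  ext i j
  exact (hf.minkowski x hx).halfHess_smul hc v _ _

theorem pdx_gLow_smul (hf : IsFinslerOn O f) (hx : x ∈ O) {c : ℝ} (hc : 0 < c) (i j k : Fin n)
    (v : Model n) : pdx k (gLow f i j) x (c • v) = pdx k (gLow f i j) x v := by
  have h : (fun y => gLow f i j y (c • v)) =ᶠ[𝓝 x] fun y => gLow f i j y v := by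
    filter_upwards [hf.isOpen.mem_nhds hx] with y hy
    simp only [gLow, hf.gMatrix_smul hy hc]
  simp only [pdx, h.fderiv_eq]

theorem spray_smul (hf : IsFinslerOn O f) (hx : x ∈ O) {c : ℝ} (hc : 0 < c) (i : Fin n)
    (v : Model n) : spray f i x (c • v) = c ^ 2 * spray f i x v := by
  have hchristoffel (j k : Fin n) :
      formalChristoffel f i j k x (c • v) = formalChristoffel f i j k x v := by
    simp only [formalChristoffel, gUp, hf.gMatrix_smul hx hc, hf.pdx_gLow_smul hx hc]
  simp only [spray, hchristoffel, PiLp.smul_apply, smul_eq_mul, Finset.mul_sum]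
  refine Finset.sum_congr rfl fun j _ => Finset.sum_congr rfl fun k _ => ?_
  ring

theorem sum_coord_mul_nonlinConn (hf : IsFinslerOn O f) (hx : x ∈ O) (hv : v ≠ 0) (i : Fin n) :
    ∑ k, v k * nonlinConn f i k x v = spray f i x v := by
  have euler := sum_coord_mul_pdv_of_homogeneous 2 (hf.smoothAt_spray hx hv i)
    fun c hc => hf.spray_smul hx hc i v
  simp only [pdv_spray, mul_left_comm _ (2 : ℝ), ← Finset.mul_sum, Nat.cast_ofNat] at euler
  linarith

/-! ### The Euler–Lagrange equation -/

theorem sum_coord_mul_covec (hf : IsFinslerOn O f) (hx : x ∈ O) (hv : v ≠ 0) :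
    ∑ k, v k * covec f k x v = 2 * energy f x v := by
  have h := map_eq_sum_basisVec (momentum (f x) v) v
  simp only [smul_eq_mul, ← covec_eq_momentum, (hf.minkowski x hx).momentum_self hv] at h
  rw [← h, energy]
  ring

theorem sum_coord_mul_gLow (hf : IsFinslerOn O f) (hx : x ∈ O) (hv : v ≠ 0) (l : Fin n) :
    ∑ k, v k * gLow f l k x v = covec f l x v := by
  have h : pdv l (fun x v => ∑ k, v k * covec f k x v) x v =
      pdv l (fun x v => 2 * energy f x v) x v :=
    hf.pdv_congr hx hv (fun _ hy _ hw => hf.sum_coord_mul_covec hy hw) l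
  rw [pdv_sum_coord_mul (hf.smoothAt_covec hx hv), pdv_const_mul, ← covec] at h
  simp_rw [gLow_eq_pdv_covec]
  linarith

theorem sum_coord_mul_pdx_covec (hf : IsFinslerOn O f) (hx : x ∈ O) (hv : v ≠ 0) (l : Fin n) :
    ∑ k, v k * pdx l (covec f k) x v = 2 * pdx l (energy f) x v := by
  rw [← pdx_sum_coord_mul (hf.smoothAt_covec hx hv), ← pdx_const_mul]
  exact hf.pdx_congr hx hv (fun _ hy _ hw => hf.sum_coord_mul_covec hy hw) l

theorem sum_coord_mul_pdx_gLow (hf : IsFinslerOn O f) (hx : x ∈ O) (hv : v ≠ 0) (j l : Fin n) :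
    ∑ k, v k * pdx j (gLow f l k) x v = pdx j (covec f l) x v := by
  rw [← pdx_sum_coord_mul (hf.smoothAt_gLow hx hv l)]
  exact hf.pdx_congr hx hv (fun _ hy _ hw => hf.sum_coord_mul_gLow hy hw l) j

theorem sum_gLow_mul_formalChristoffel (hf : IsFinslerOn O f) (hx : x ∈ O) (hv : v ≠ 0)
    (m j k : Fin n) : ∑ i, gLow f m i x v * formalChristoffel f i j k x v =
      (1 / 2) * (pdx j (gLow f m k) x v + pdx k (gLow f j m) x v - pdx m (gLow f j k) x v) := by
  let T : Fin n → ℝ := fun l =>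
    pdx j (gLow f l k) x v + pdx k (gLow f j l) x v - pdx l (gLow f j k) x v
  have hinv : (gMatrix (f x) v).mulVec ((gMatrix (f x) v)⁻¹.mulVec T) = T := by
    rw [Matrix.mulVec_mulVec, Matrix.mul_nonsing_inv _ (hf.isUnit_det hx hv), Matrix.one_mulVec]
  calc ∑ i, gLow f m i x v * formalChristoffel f i j k x v
      = (1 / 2) * (gMatrix (f x) v).mulVec ((gMatrix (f x) v)⁻¹.mulVec T) m := by
        simp only [Matrix.mulVec, dotProduct, Finset.mul_sum, formalChristoffel, gLow, gUp, T]
        exact Finset.sum_congr rfl fun i _ => Finset.sum_congr rfl fun l _ => by ring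
    _ = (1 / 2) * T m := by rw [hinv]

theorem sum_gLow_mul_spray (hf : IsFinslerOn O f) (hx : x ∈ O) (hv : v ≠ 0) (m : Fin n) :
    ∑ i, gLow f m i x v * spray f i x v =
      ∑ j, v j * pdx j (covec f m) x v - pdx m (energy f) x v := by
  have hcontract : ∑ i, gLow f m i x v * spray f i x v =
      ∑ j, ∑ k, v j * (v k * ∑ i, gLow f m i x v * formalChristoffel f i j k x v) := by
    simp only [spray, Finset.mul_sum]
    rw [Finset.sum_comm]
    refine Finset.sum_congr rfl fun j _ => ?_
    rw [Finset.sum_comm]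
    exact Finset.sum_congr rfl fun k _ => Finset.sum_congr rfl fun i _ => by ring
  have hsum_jk : ∑ j, ∑ k, v j * (v k * pdx j (gLow f m k) x v) =
      ∑ j, v j * pdx j (covec f m) x v := by
    simp only [← Finset.mul_sum, hf.sum_coord_mul_pdx_gLow hx hv]
  have hsum_kj : ∑ j, ∑ k, v j * (v k * pdx k (gLow f j m) x v) =
      ∑ j, v j * pdx j (covec f m) x v := by
    rw [← hsum_jk, Finset.sum_comm]
    simp only [hf.pdx_gLow_symm hx hv _ m, mul_left_comm]
  have hsum_m : ∑ j, ∑ k, v j * (v k * pdx m (gLow f j k) x v) = 2 * pdx m (energy f) x v := by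
    simp only [← Finset.mul_sum, hf.sum_coord_mul_pdx_gLow hx hv, hf.sum_coord_mul_pdx_covec hx hv]
  have hsplit (a b c : Fin n → Fin n → ℝ) :
      ∑ j, ∑ k, v j * (v k * ((1 / 2) * (a j k + b j k - c j k))) =
        (1 / 2) * (∑ j, ∑ k, v j * (v k * a j k) + ∑ j, ∑ k, v j * (v k * b j k) -
          ∑ j, ∑ k, v j * (v k * c j k)) := by
    simp only [Finset.mul_sum, ← Finset.sum_add_distrib, ← Finset.sum_sub_distrib]
    exact Finset.sum_congr rfl fun j _ => Finset.sum_congr rfl fun k _ => by ring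
  simp only [hcontract, hf.sum_gLow_mul_formalChristoffel hx hv, hsplit, hsum_jk, hsum_kj, hsum_m]
  ring

/-! ### The metric along the geodesic flow -/

/-- The velocity derivative of the Euler–Lagrange equation. -/
theorem sprayDeriv_gLow_eq_add_curl (hf : IsFinslerOn O f) (hx : x ∈ O) (hv : v ≠ 0)
    (k m : Fin n) : sprayDeriv f (gLow f k m) x v =
      2 * ∑ i, gLow f m i x v * nonlinConn f i k x v +
        (pdx m (covec f k) x v - pdx k (covec f m) x v) := by
  have hp := hf.smoothAt_covec hx hv m
  have hE := hf.smoothAt_energy hx hv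
  have hlhs : pdv k (fun x v => ∑ i, gLow f m i x v * spray f i x v) x v =
      ∑ i, spray f i x v * pdv i (gLow f k m) x v +
        2 * ∑ i, gLow f m i x v * nonlinConn f i k x v := by
    rw [pdv_sum fun i _ => (hf.smoothAt_gLow hx hv m i).mul (hf.smoothAt_spray hx hv i),
      Finset.mul_sum, ← Finset.sum_add_distrib]
    refine Finset.sum_congr rfl fun i _ => ?_
    rw [pdv_mul (hf.smoothAt_gLow hx hv m i) (hf.smoothAt_spray hx hv i), pdv_spray,
      hf.pdv_gLow_rotate hx hv k m]
    ring
  have hrhs : pdv k (fun x v => ∑ j, v j * pdx j (covec f m) x v - pdx m (energy f) x v) x v =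
      pdx k (covec f m) x v + ∑ j, v j * pdx j (gLow f k m) x v - pdx m (covec f k) x v := by
    rw [pdv_sub (SmoothAt.sum fun j _ => (SmoothAt.coord j).mul (hp.pdx j)) (hE.pdx m),
      pdv_sum_coord_mul hp.pdx, pdv_pdx_comm hE]
    simp only [pdv_pdx_comm hp, ← gLow_eq_pdv_covec]
    rfl
  have heq := hf.pdv_congr hx hv (fun _ hy _ hw => hf.sum_gLow_mul_spray hy hw m) k
  rw [hlhs, hrhs] at heq
  rw [sprayDeriv]
  linarith

theorem sprayDeriv_gLow_symm (hf : IsFinslerOn O f) (hx : x ∈ O) (hv : v ≠ 0) (k m : Fin n) :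
    sprayDeriv f (gLow f k m) x v = sprayDeriv f (gLow f m k) x v := by
  simp only [sprayDeriv, hf.pdx_gLow_symm hx hv _ k m, hf.pdv_gLow_symm hx hv _ k m]

theorem sprayDeriv_gLow (hf : IsFinslerOn O f) (hx : x ∈ O) (hv : v ≠ 0) (k m : Fin n) :
    sprayDeriv f (gLow f k m) x v =
      ∑ i, gLow f m i x v * nonlinConn f i k x v + ∑ i, gLow f k i x v * nonlinConn f i m x v := by
  linarith [hf.sprayDeriv_gLow_eq_add_curl hx hv k m, hf.sprayDeriv_gLow_eq_add_curl hx hv m k,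
    hf.sprayDeriv_gLow_symm hx hv k m]

theorem sum_gLow_mul_nonlinConn_sub_swap (hf : IsFinslerOn O f) (hx : x ∈ O) (hv : v ≠ 0)
    (k m : Fin n) :
    ∑ i, gLow f m i x v * nonlinConn f i k x v - ∑ i, gLow f k i x v * nonlinConn f i m x v =
      pdx k (covec f m) x v - pdx m (covec f k) x v := by
  linarith [hf.sprayDeriv_gLow_eq_add_curl hx hv k m, hf.sprayDeriv_gLow_eq_add_curl hx hv m k,
    hf.sprayDeriv_gLow_symm hx hv k m]

theorem pdx_energy (hf : IsFinslerOn O f) (hx : x ∈ O) (hv : v ≠ 0) (l : Fin n) :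
    pdx l (energy f) x v = ∑ j, nonlinConn f j l x v * covec f j x v := by
  have hcovec : ∑ k, v k * ∑ i, gLow f k i x v * nonlinConn f i l x v =
      ∑ j, nonlinConn f j l x v * covec f j x v := by
    simp only [← hf.sum_coord_mul_gLow hx hv, Finset.mul_sum]
    rw [Finset.sum_comm]
    refine Finset.sum_congr rfl fun j _ => Finset.sum_congr rfl fun k _ => ?_
    rw [hf.gLow_symm hx hv]
    ring
  have hspray : ∑ k, v k * ∑ i, gLow f l i x v * nonlinConn f i k x v =
      ∑ i, gLow f l i x v * spray f i x v := by
    simp only [← hf.sum_coord_mul_nonlinConn hx hv, Finset.mul_sum]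
    rw [Finset.sum_comm]
    simp only [mul_left_comm]
  have hcurl : ∑ k, v k * (∑ i, gLow f k i x v * nonlinConn f i l x v
      - ∑ i, gLow f l i x v * nonlinConn f i k x v) =
      ∑ k, v k * (pdx l (covec f k) x v - pdx k (covec f l) x v) := by
    simp only [hf.sum_gLow_mul_nonlinConn_sub_swap hx hv]
  simp only [mul_sub, Finset.sum_sub_distrib, hcovec, hspray, hf.sum_coord_mul_pdx_covec hx hv,
    hf.sum_gLow_mul_spray hx hv] at hcurl
  linarith

end IsFinslerOn

end FinslerCoordinates

/-! ### Vector fields and curves in coordinates -/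

section PartialDerivatives

variable {n : ℕ}

/-- The partial derivative `∂φ/∂xⁱ` of a function of position only. -/
def pd (i : Fin n) (φ : Model n → ℝ) (x : Model n) : ℝ := fderiv ℝ φ x (basisVec i)

variable {ι : Type*} {s : Finset ι} {φ ψ : Model n → ℝ} {χ : ι → Model n → ℝ} {x v : Model n}

theorem contDiffAt_pd (hφ : ContDiffAt ℝ ∞ φ x) (i : Fin n) : ContDiffAt ℝ ∞ (pd i φ) x :=
  (hφ.fderiv_right (by simp)).clm_apply contDiffAt_const

theorem pd_congr (h : φ =ᶠ[𝓝 x] ψ) (i : Fin n) : pd i φ x = pd i ψ x := by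
  simp only [pd, h.fderiv_eq]

theorem pd_add (hφ : DifferentiableAt ℝ φ x) (hψ : DifferentiableAt ℝ ψ x) (i : Fin n) :
    pd i (fun y => φ y + ψ y) x = pd i φ x + pd i ψ x := by
  simp only [pd, fderiv_fun_add hφ hψ, add_apply]

theorem pd_mul (hφ : DifferentiableAt ℝ φ x) (hψ : DifferentiableAt ℝ ψ x) (i : Fin n) :
    pd i (fun y => φ y * ψ y) x = pd i φ x * ψ x + φ x * pd i ψ x := by
  simp only [pd, fderiv_fun_mul hφ hψ, add_apply, smul_apply, smul_eq_mul]
  ring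

theorem pd_sum (hχ : ∀ j ∈ s, DifferentiableAt ℝ (χ j) x) (i : Fin n) :
    pd i (fun y => ∑ j ∈ s, χ j y) x = ∑ j ∈ s, pd i (χ j) x := by
  simp [pd, fderiv_fun_sum hχ]

theorem pd_comm (hφ : ContDiffAt ℝ 2 φ x) (i j : Fin n) : pd i (pd j φ) x = pd j (pd i φ) x :=
  fderiv_fderiv_apply_comm hφ _ _

theorem pd_comp_field {H : Model n → Model n → ℝ} {W : Model n → Model n}
    (hH : DifferentiableAt ℝ (Function.uncurry H) (x, W x)) (hW : DifferentiableAt ℝ W x)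
    (k : Fin n) : pd k (fun y => H y (W y)) x =
      pdx k H x (W x) + ∑ j, pd k (fun y => W y j) x * pdv j H x (W x) := by
  have hgraph : HasFDerivAt (fun y => (y, W y)) _ x := (hasFDerivAt_id x).prodMk hW.hasFDerivAt
  have hcomp : HasFDerivAt (fun y => H y (W y)) _ x :=
    HasFDerivAt.comp (g := Function.uncurry H) x hH.hasFDerivAt hgraph
  have hcoord (j : Fin n) : fderiv ℝ W x (basisVec k) j = pd k (fun y => W y j) x := by
    have : HasFDerivAt (fun y => W y j) _ x :=
      (EuclideanSpace.proj j : Model n →L[ℝ] ℝ).hasFDerivAt.comp x hW.hasFDerivAt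
    rw [pd, this.fderiv]
    rfl
  rw [pd, hcomp.fderiv, ContinuousLinearMap.comp_apply, ContinuousLinearMap.prod_apply,
    fderiv_uncurry_apply hH]
  simp [basisVec_apply, hcoord]

theorem SmoothAt.comp_field {H : Model n → Model n → ℝ} {W : Model n → Model n}
    (hH : SmoothAt H x (W x)) (hW : ContDiffAt ℝ ∞ W x) :
    ContDiffAt ℝ ∞ (fun y => H y (W y)) x :=
  ContDiffAt.comp (g := Function.uncurry H) (f := fun y => (y, W y)) x hH
    (contDiffAt_id.prodMk hW)

theorem sprayDeriv_eq_fderiv {f H : Model n → Model n → ℝ}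
    (hH : DifferentiableAt ℝ (Function.uncurry H) (x, v)) :
    sprayDeriv f H x v =
      fderiv ℝ (Function.uncurry H) (x, v) (v, WithLp.toLp 2 fun j => -spray f j x v) := by
  rw [fderiv_uncurry_apply hH]
  simp [sprayDeriv, sub_eq_add_neg]

theorem hasDerivAt_along_geodesic {f H : Model n → Model n → ℝ} {c w : ℝ → Model n} {t : ℝ}
    (hH : DifferentiableAt ℝ (Function.uncurry H) (c t, w t)) (hc : HasDerivAt c (w t) t)
    (hw : ∀ i, HasDerivAt (fun s => w s i) (-spray f i (c t) (w t)) t) :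
    HasDerivAt (fun s => H (c s) (w s)) (sprayDeriv f H (c t) (w t)) t := by
  have hw' : HasDerivAt w (WithLp.toLp 2 fun i => -spray f i (c t) (w t)) t :=
    (PiLp.continuousLinearEquiv 2 ℝ fun _ : Fin n => ℝ).symm.hasFDerivAt.comp_hasDerivAt t
      (hasDerivAt_pi.2 hw)
  rw [sprayDeriv_eq_fderiv hH]
  exact hH.hasFDerivAt.comp_hasDerivAt (f := fun s => (c s, w s)) t (hc.prodMk hw')

end PartialDerivatives

/-! ### The weight along the geodesic flow -/

theorem hasFDerivAt_log_sqrt_det {X ι : Type*} [NormedAddCommGroup X] [NormedSpace ℝ X]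
    [Fintype ι] [DecidableEq ι] {A : X → Matrix ι ι ℝ} {A' : ι → ι → X →L[ℝ] ℝ} {p : X}
    (hA : ∀ i j, HasFDerivAt (fun q => A q i j) (A' i j) p) (hpos : 0 < (A p).det) :
    HasFDerivAt (fun q => Real.log (Real.sqrt (A q).det))
      ((1 / 2 : ℝ) • ∑ i, ∑ j, (A p)⁻¹ j i • A' i j) p := by
  have hroot : Real.sqrt (A p).det ≠ 0 := (Real.sqrt_pos.2 hpos).ne'
  refine (((hasFDerivAt_matrix_det hA).sqrt hpos.ne').log hroot).congr_fderiv ?_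
  simp only [Matrix.inv_def, Ring.inverse_eq_inv', Matrix.smul_apply, smul_eq_mul,
    ← smul_smul, ← Finset.smul_sum]
  rw [smul_smul, smul_smul]
  congr 1
  have hsq := Real.mul_self_sqrt hpos.le
  field_simp
  rw [sq, hsq]

/-- The first derivative of the weight function along the geodesic flow. -/
def weightFlow {n : ℕ} (f : Model n → Model n → ℝ) (Φ : Model n → ℝ) (x v : Model n) : ℝ :=
  ∑ i, nonlinConn f i i x v - ∑ j, v j * pd j Φ x

theorem sprayDeriv_sub {n : ℕ} {f H H' : Model n → Model n → ℝ} {x v : Model n}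
    (hH : SmoothAt H x v) (hH' : SmoothAt H' x v) :
    sprayDeriv f (fun x v => H x v - H' x v) x v = sprayDeriv f H x v - sprayDeriv f H' x v := by
  simp only [sprayDeriv, pdx_sub hH hH', pdv_sub hH hH', mul_sub, Finset.sum_sub_distrib]
  ring

namespace IsFinslerOn

variable {n : ℕ} {O : Set (Model n)} {f : Model n → Model n → ℝ} {Φ : Model n → ℝ}
  {x v : Model n}

theorem mono (hf : IsFinslerOn O f) {O' : Set (Model n)} (hO' : IsOpen O') (h : O' ⊆ O) :
    IsFinslerOn O' f where
  isOpen := hO'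
  smoothAt x hx := hf.smoothAt x (h hx)
  minkowski x hx := hf.minkowski x (h hx)

theorem smoothAt_log_sqrt_det (hf : IsFinslerOn O f) (hx : x ∈ O) (hv : v ≠ 0) :
    SmoothAt (fun x v => Real.log (Real.sqrt (gMatrix (f x) v).det)) x v :=
  have hdet : ContDiffAt ℝ ∞ (fun q : Model n × Model n => (gMatrix (f q.1) q.2).det) (x, v) :=
    contDiffAt_matrix_det (hf.smoothAt_gLow hx hv)
  (hdet.sqrt (hf.det_pos hx hv).ne').log (Real.sqrt_pos.2 (hf.det_pos hx hv)).ne'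

theorem sprayDeriv_log_sqrt_det (hf : IsFinslerOn O f) (hx : x ∈ O) (hv : v ≠ 0) :
    sprayDeriv f (fun x v => Real.log (Real.sqrt (gMatrix (f x) v).det)) x v =
      ∑ i, nonlinConn f i i x v := by
  set g := gMatrix (f x) v
  let N : Matrix (Fin n) (Fin n) ℝ := Matrix.of fun i j => nonlinConn f i j x v
  have hunit : IsUnit g.det := hf.isUnit_det hx hv
  have hsymm : g.transpose = g := Matrix.ext fun i j => hf.gLow_symm hx hv j i
  have hjacobi : sprayDeriv f (fun x v => Real.log (Real.sqrt (gMatrix (f x) v).det)) x v =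
      (1 / 2) * ∑ i, ∑ j, g⁻¹ j i * sprayDeriv f (gLow f i j) x v := by
    have hA := hasFDerivAt_log_sqrt_det (A := fun q : Model n × Model n => gMatrix (f q.1) q.2)
      (fun i j => (hf.smoothAt_gLow hx hv i j).differentiableAt.hasFDerivAt) (hf.det_pos hx hv)
    rw [sprayDeriv_eq_fderiv (hf.smoothAt_log_sqrt_det hx hv).differentiableAt]
    refine (DFunLike.congr_fun hA.fderiv _).trans ?_
    simp [sprayDeriv_eq_fderiv (hf.smoothAt_gLow hx hv _ _).differentiableAt, g]
  have hflow (i j : Fin n) :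
      sprayDeriv f (gLow f i j) x v = ((g * N).transpose + g * N) i j :=
    hf.sprayDeriv_gLow hx hv i j
  have htrace (A : Matrix (Fin n) (Fin n) ℝ) : ∑ i, ∑ j, g⁻¹ j i * A i j = (g⁻¹ * A).trace :=
    Finset.sum_comm
  have hN : (g⁻¹ * (g * N)).trace = N.trace := by rw [Matrix.nonsing_inv_mul_cancel_left _ _ hunit]
  have hNt : (g⁻¹ * (g * N).transpose).trace = N.trace := by
    rw [← Matrix.trace_transpose, Matrix.transpose_mul, Matrix.transpose_transpose,
      Matrix.transpose_nonsing_inv, hsymm, Matrix.trace_mul_comm, hN]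
  simp_rw [hjacobi, hflow]
  rw [htrace, mul_add, Matrix.trace_add, hN, hNt]
  change 1 / 2 * (N.trace + N.trace) = N.trace
  ring

theorem smoothAt_weightCoord (hf : IsFinslerOn O f) (hΦ : ContDiffAt ℝ ∞ Φ x) (hx : x ∈ O)
    (hv : v ≠ 0) : SmoothAt (weightCoord f Φ) x v :=
  (hf.smoothAt_log_sqrt_det hx hv).sub (smoothAt_of_contDiffAt hΦ)

theorem smoothAt_weightFlow (hf : IsFinslerOn O f) (hΦ : ContDiffAt ℝ ∞ Φ x) (hx : x ∈ O)
    (hv : v ≠ 0) : SmoothAt (weightFlow f Φ) x v :=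
  (SmoothAt.sum fun i _ => hf.smoothAt_nonlinConn hx hv i i).sub (SmoothAt.sum fun j _ =>
    (SmoothAt.coord j).mul (smoothAt_of_contDiffAt (contDiffAt_pd hΦ j)))

theorem sprayDeriv_weightCoord (hf : IsFinslerOn O f) (hΦ : ContDiffAt ℝ ∞ Φ x) (hx : x ∈ O)
    (hv : v ≠ 0) : sprayDeriv f (weightCoord f Φ) x v = weightFlow f Φ x v := by
  refine (sprayDeriv_sub (hf.smoothAt_log_sqrt_det hx hv) (smoothAt_of_contDiffAt hΦ)).trans ?_
  rw [hf.sprayDeriv_log_sqrt_det hx hv]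
  simp [sprayDeriv, weightFlow, pdx, pdv, pd]

theorem sprayDeriv_weightFlow (hf : IsFinslerOn O f) (hΦ : ContDiffAt ℝ ∞ Φ x) (hx : x ∈ O)
    (hv : v ≠ 0) : sprayDeriv f (weightFlow f Φ) x v =
      ∑ i, ∑ j, v j * pdx j (nonlinConn f i i) x v
        - ∑ i, ∑ j, spray f j x v * pdv j (nonlinConn f i i) x v
        - ∑ i, ∑ j, v i * (v j * pd i (pd j Φ) x) + ∑ j, spray f j x v * pd j Φ x := by
  have hN : ∀ i ∈ Finset.univ, SmoothAt (nonlinConn f i i) x v := fun i _ =>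
    hf.smoothAt_nonlinConn hx hv i i
  have hdΦ : ∀ j, SmoothAt (fun x _ => pd j Φ x) x v := fun j =>
    smoothAt_of_contDiffAt (contDiffAt_pd hΦ j)
  have hconn : sprayDeriv f (fun x v => ∑ i, nonlinConn f i i x v) x v =
      ∑ i, ∑ j, v j * pdx j (nonlinConn f i i) x v
        - ∑ i, ∑ j, spray f j x v * pdv j (nonlinConn f i i) x v := by
    simp only [sprayDeriv, pdx_sum hN, pdv_sum hN, Finset.mul_sum]
    exact congrArg₂ (· - ·) Finset.sum_comm Finset.sum_comm
  have hdens : sprayDeriv f (fun x v => ∑ j, v j * pd j Φ x) x v =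
      ∑ i, ∑ j, v i * (v j * pd i (pd j Φ) x) - ∑ j, spray f j x v * pd j Φ x := by
    simp only [sprayDeriv, pdx_sum_coord_mul hdΦ, pdv_sum_coord_mul hdΦ, Finset.mul_sum]
    congr 1
    exact Finset.sum_congr rfl fun j _ => by simp [pdv]
  refine (sprayDeriv_sub (SmoothAt.sum hN)
    (SmoothAt.sum fun j _ => (SmoothAt.coord j).mul (hdΦ j))).trans ?_
  rw [hconn, hdens]
  ring

end IsFinslerOn

/-! ### Gradient fields -/

section ImplicitFunction

variable {E G H : Type*} [NormedAddCommGroup E] [NormedSpace ℝ E] [NormedAddCommGroup G]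
  [NormedSpace ℝ G] [NormedAddCommGroup H] [NormedSpace ℝ H]

theorem isInvertible_of_injective [FiniteDimensional ℝ G] [FiniteDimensional ℝ H]
    (hGH : Module.finrank ℝ G = Module.finrank ℝ H) {l : G →L[ℝ] H}
    (hl : Function.Injective l) : l.IsInvertible :=
  ⟨(LinearEquiv.ofInjectiveOfFinrankEq (l : G →ₗ[ℝ] H) hl hGH).toContinuousLinearEquiv,
    ContinuousLinearMap.ext fun _ => rfl⟩

theorem contDiffAt_of_eventually_unique [CompleteSpace E] [CompleteSpace G] [CompleteSpace H]
    {k : ℕ∞ω} (hk : k ≠ 0) {T : E × G → H} {W : E → G} {x : E}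
    (hT : ContDiffAt ℝ k T (x, W x))
    (hinv : (fderiv ℝ T (x, W x) ∘L .inr ℝ E G).IsInvertible)
    (hunique : ∀ᶠ q in 𝓝 (x, W x), T q = T (x, W x) → W q.1 = q.2) : ContDiffAt ℝ k W x := by
  have hψ := hT.contDiffAt_implicitFunction hk hinv
  have hself : hT.implicitFunction hk hinv x = W x := hT.implicitFunction_apply_self hk hinv
  have hgraph : Filter.Tendsto (fun y => (y, hT.implicitFunction hk hinv y)) (𝓝 x)
      (𝓝 (x, W x)) := by
    simpa only [hself, id] using (continuousAt_id.prodMk hψ.continuousAt).tendsto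
  refine hψ.congr_of_eventuallyEq ?_
  filter_upwards [hT.eventually_apply_implicitFunction hk hinv, hgraph.eventually hunique]
    with y hy hy' using hy' hy

end ImplicitFunction

section GradientField

variable {n : ℕ} {O : Set (Model n)} {f : Model n → Model n → ℝ} {U : Model n → ℝ}
  {W : Model n → Model n} {x v : Model n}

/-- `W` is the nowhere vanishing gradient of the smooth potential `U` on `O`: its Legendre transform
is `DU`. -/
structure IsGradientOn (O : Set (Model n)) (f : Model n → Model n → ℝ) (U : Model n → ℝ)
    (W : Model n → Model n) : Prop where
  contDiffOn_potential : ContDiffOn ℝ ∞ U O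
  ne_zero : ∀ y ∈ O, W y ≠ 0
  momentum_eq : ∀ y ∈ O, momentum (f y) (W y) = fderiv ℝ U y

theorem IsMinkowskiNorm.isInvertible_fderiv_momentum {h : Model n → ℝ} (hh : IsMinkowskiNorm h)
    (hv : v ≠ 0) : (fderiv ℝ (momentum h) v).IsInvertible := by
  have hdual : Module.finrank ℝ (Model n) = Module.finrank ℝ (Model n →L[ℝ] ℝ) :=
    Subspace.dual_finrank_eq.symm.trans LinearMap.toContinuousLinearMap.finrank_eq
  refine isInvertible_of_injective hdual fun a a' h => hh.eq_of_halfHess_eq hv fun b => ?_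
  rw [hh.halfHess_eq hv, hh.halfHess_eq hv, h]

theorem IsFinslerOn.contDiffAt_uncurry_momentum (hf : IsFinslerOn O f) (hx : x ∈ O) (hv : v ≠ 0) :
    ContDiffAt ℝ ∞ (fun q : Model n × Model n => momentum (f q.1) q.2) (x, v) := by
  have hcoord : (fun q : Model n × Model n => momentum (f q.1) q.2) =
      fun q => ∑ i, covec f i q.1 q.2 • (EuclideanSpace.proj i : Model n →L[ℝ] ℝ) := by
    ext q a
    rw [map_eq_sum_basisVec]
    simp [covec_eq_momentum, mul_comm]
  rw [hcoord]
  exact ContDiffAt.sum fun i _ => ContDiffAt.smul (hf.smoothAt_covec hx hv i) contDiffAt_const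

theorem IsGradientOn.contDiffAt (hW : IsGradientOn O f U W) (hf : IsFinslerOn O f) (hx : x ∈ O) :
    ContDiffAt ℝ ∞ W x := by
  have hv := hW.ne_zero x hx
  let T : Model n × Model n → Model n →L[ℝ] ℝ := fun q => momentum (f q.1) q.2 - fderiv ℝ U q.1
  have hdU : ContDiffAt ℝ ∞ (fderiv ℝ U) x :=
    (hW.contDiffOn_potential.contDiffAt (hf.isOpen.mem_nhds hx)).fderiv_right (by simp)
  have hT : ContDiffAt ℝ ∞ T (x, W x) := (hf.contDiffAt_uncurry_momentum hx hv).sub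
    (hdU.comp (x, W x) contDiffAt_fst)
  have hpartial : fderiv ℝ T (x, W x) ∘L .inr ℝ _ _ = fderiv ℝ (momentum (f x)) (W x) := by
    rw [← fderiv_sub_const (f := momentum (f x)) (fderiv ℝ U x)]
    exact ((hT.differentiableAt (by simp)).hasFDerivAt.comp (W x)
      (hasFDerivAt_prodMk_right x (W x))).fderiv.symm
  refine contDiffAt_of_eventually_unique (by simp) hT ?_ ?_
  · rw [hpartial]
    exact (hf.minkowski x hx).isInvertible_fderiv_momentum hv
  · filter_upwards [hf.eventually hx hv] with ⟨y, w⟩ ⟨hy, hw⟩ hyw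
    simp only [T, hW.momentum_eq x hx, sub_self, sub_eq_zero] at hyw
    exact (hf.minkowski y hy).momentum_injective (hW.ne_zero y hy) hw
      ((hW.momentum_eq y hy).trans hyw.symm)

end GradientField

/-! ### The Bochner identity in coordinates -/

section CovariantDerivative

open scoped Matrix

variable {n : ℕ}

/-- The matrix `∂Wⁱ/∂xʲ + Nⁱ_j(W)` of the covariant derivative `D^W W` of a vector field with
reference vector `W` itself; for a gradient field it represents the Hessian of the potential. -/
def covDeriv (f : Model n → Model n → ℝ) (W : Model n → Model n) (x : Model n) :
    Matrix (Fin n) (Fin n) ℝ :=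
  Matrix.of fun i j => pd j (fun y => W y i) x + nonlinConn f i j x (W x)

/-- The divergence of `W` with respect to the measure `e^Φ dx`. -/
def coordDiv (Φ : Model n → ℝ) (W : Model n → Model n) (x : Model n) : ℝ :=
  ∑ i, (pd i (fun y => W y i) x + W x i * pd i Φ x)

/-- The acceleration `D^W_W W` of the integral curves of `W`. -/
def accel (f : Model n → Model n → ℝ) (W : Model n → Model n) (x : Model n) : Model n :=
  WithLp.toLp 2 (covDeriv f W x *ᵥ W x)

variable {O : Set (Model n)} {f : Model n → Model n → ℝ} {U Φ : Model n → ℝ}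
  {W W' : Model n → Model n} {x : Model n}

theorem contDiffAt_coord (hW : ContDiffAt ℝ ∞ W x) (i : Fin n) :
    ContDiffAt ℝ ∞ (fun y => W y i) x :=
  contDiffAt_euclidean.1 hW i

theorem coordDiv_congr (h : W =ᶠ[𝓝 x] W') : coordDiv Φ W x = coordDiv Φ W' x := by
  refine Finset.sum_congr rfl fun i _ => ?_
  have hi : (fun y => W y i) =ᶠ[𝓝 x] fun y => W' y i := h.fun_comp fun w : Model n => w i
  rw [pd_congr hi, h.eq_of_nhds]

theorem contDiffAt_coordDiv (hΦ : ContDiffAt ℝ ∞ Φ x) (hW : ContDiffAt ℝ ∞ W x) :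
    ContDiffAt ℝ ∞ (coordDiv Φ W) x :=
  ContDiffAt.sum fun i _ => (contDiffAt_pd (contDiffAt_coord hW i) i).add
    ((contDiffAt_coord hW i).mul (contDiffAt_pd hΦ i))

theorem pd_coordDiv (hΦ : ContDiffAt ℝ ∞ Φ x) (hW : ContDiffAt ℝ ∞ W x) (k : Fin n) :
    pd k (coordDiv Φ W) x = ∑ i, (pd k (pd i fun y => W y i) x +
      (pd k (fun y => W y i) x * pd i Φ x + W x i * pd k (pd i Φ) x)) := by
  have hWi (i : Fin n) : DifferentiableAt ℝ (fun y => W y i) x :=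
    (contDiffAt_coord hW i).differentiableAt (by simp)
  have hdW (i : Fin n) : DifferentiableAt ℝ (pd i fun y => W y i) x :=
    (contDiffAt_pd (contDiffAt_coord hW i) i).differentiableAt (by simp)
  have hdΦ (i : Fin n) : DifferentiableAt ℝ (pd i Φ) x :=
    (contDiffAt_pd hΦ i).differentiableAt (by simp)
  refine (pd_sum (fun i _ => (hdW i).fun_add ((hWi i).fun_mul (hdΦ i))) k).trans ?_
  refine Finset.sum_congr rfl fun i _ => ?_
  rw [pd_add (hdW i) ((hWi i).fun_mul (hdΦ i)), pd_mul (hWi i) (hdΦ i)]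

theorem fderiv_coordDiv_self (hΦ : ContDiffAt ℝ ∞ Φ x) (hW : ContDiffAt ℝ ∞ W x) :
    fderiv ℝ (coordDiv Φ W) x (W x) =
      ∑ i, ∑ j, W x j * pd j (pd i fun y => W y i) x
      + ∑ i, ∑ j, W x j * pd j (fun y => W y i) x * pd i Φ x
      + ∑ i, ∑ j, W x i * (W x j * pd i (pd j Φ) x) := by
  rw [map_eq_sum_basisVec]
  change ∑ k, W x k * pd k (coordDiv Φ W) x = _
  simp only [pd_coordDiv hΦ hW, Finset.mul_sum, mul_add, Finset.sum_add_distrib]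
  rw [Finset.sum_comm (f := fun i j => W x j * pd j (pd i fun y => W y i) x),
    Finset.sum_comm (f := fun i j => W x j * pd j (fun y => W y i) x * pd i Φ x)]
  simp only [mul_assoc]
  ring

theorem trace_covDeriv_sq (f : Model n → Model n → ℝ) (W : Model n → Model n) (x : Model n) :
    (covDeriv f W x * covDeriv f W x).trace =
      ∑ i, ∑ j, pd i (fun y => W y j) x * pd j (fun y => W y i) x
      + ∑ i, ∑ j, pd i (fun y => W y j) x * (2 * nonlinConn f i j x (W x))
      + ∑ i, ∑ j, nonlinConn f i j x (W x) * nonlinConn f j i x (W x) := by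
  have hswap : ∑ i, ∑ j, pd j (fun y => W y i) x * nonlinConn f j i x (W x) =
      ∑ i, ∑ j, pd i (fun y => W y j) x * nonlinConn f i j x (W x) := Finset.sum_comm
  calc (covDeriv f W x * covDeriv f W x).trace
      = ∑ i, ∑ j, pd i (fun y => W y j) x * pd j (fun y => W y i) x
      + ∑ i, ∑ j, pd i (fun y => W y j) x * nonlinConn f i j x (W x)
      + ∑ i, ∑ j, pd j (fun y => W y i) x * nonlinConn f j i x (W x)
      + ∑ i, ∑ j, nonlinConn f i j x (W x) * nonlinConn f j i x (W x) := by
        simp only [Matrix.trace, Matrix.diag, Matrix.mul_apply, ← Finset.sum_add_distrib]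
        refine Finset.sum_congr rfl fun i _ => Finset.sum_congr rfl fun j _ => ?_
        simp only [covDeriv, Matrix.of_apply]
        ring
    _ = _ := by
        simp only [hswap, mul_left_comm _ (2 : ℝ), ← Finset.mul_sum]
        ring

namespace IsFinslerOn

theorem accel_apply (hf : IsFinslerOn O f) (hx : x ∈ O) (hv : W x ≠ 0) (i : Fin n) :
    accel f W x i = ∑ j, W x j * pd j (fun y => W y i) x + spray f i x (W x) := by
  rw [← hf.sum_coord_mul_nonlinConn hx hv, ← Finset.sum_add_distrib]
  simp only [accel, Matrix.mulVec, dotProduct]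
  refine Finset.sum_congr rfl fun j _ => ?_
  simp only [covDeriv, Matrix.of_apply]
  ring

theorem pd_accel (hf : IsFinslerOn O f) (hW : ContDiffAt ℝ ∞ W x) (hx : x ∈ O) (hv : W x ≠ 0)
    (i : Fin n) : pd i (fun y => accel f W y i) x =
      ∑ j, (pd i (fun y => W y j) x * pd j (fun y => W y i) x
        + W x j * pd j (pd i fun y => W y i) x)
      + (pdx i (spray f i) x (W x)
        + ∑ j, pd i (fun y => W y j) x * (2 * nonlinConn f i j x (W x))) := by
  have hWj (j : Fin n) : DifferentiableAt ℝ (fun y => W y j) x :=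
    (contDiffAt_coord hW j).differentiableAt (by simp)
  have hdW (j : Fin n) : DifferentiableAt ℝ (pd j fun y => W y i) x :=
    (contDiffAt_pd (contDiffAt_coord hW i) j).differentiableAt (by simp)
  have hG : DifferentiableAt ℝ (fun y => spray f i y (W y)) x :=
    ((hf.smoothAt_spray hx hv i).comp_field hW).differentiableAt (by simp)
  have hnear : (fun y => accel f W y i) =ᶠ[𝓝 x]
      fun y => ∑ j, W y j * pd j (fun z => W z i) y + spray f i y (W y) := by
    filter_upwards [hf.isOpen.mem_nhds hx, hW.continuousAt.eventually_ne hv] with y hy hy0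
    exact hf.accel_apply hy hy0 i
  rw [pd_congr hnear, pd_add (.fun_sum fun j _ => (hWj j).fun_mul (hdW j)) hG,
    pd_sum fun j _ => (hWj j).fun_mul (hdW j), pd_comp_field
      (hf.smoothAt_spray hx hv i).differentiableAt (hW.differentiableAt (by simp))]
  simp only [pdv_spray, pd_mul (hWj _) (hdW _),
    pd_comm ((contDiffAt_coord hW i).of_le (WithTop.coe_le_coe.mpr le_top)) i]

/-- The second derivatives of `W` cancel, and the quadratic terms in `DW` and `N` assemble to the
trace of the square of the covariant derivative and to the terms in the Ricci curvature. -/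
theorem coordDiv_accel_sub (hf : IsFinslerOn O f) (hΦ : ContDiffAt ℝ ∞ Φ x)
    (hW : ContDiffAt ℝ ∞ W x) (hx : x ∈ O) (hv : W x ≠ 0) :
    coordDiv Φ (accel f W) x - fderiv ℝ (coordDiv Φ W) x (W x) =
      (covDeriv f W x * covDeriv f W x).trace + ricciCoord f x (W x)
        + sprayDeriv f (weightFlow f Φ) x (W x) := by
  have hdiv : coordDiv Φ (accel f W) x =
      ∑ i, ∑ j, pd i (fun y => W y j) x * pd j (fun y => W y i) x
      + ∑ i, ∑ j, W x j * pd j (pd i fun y => W y i) x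
      + ∑ i, pdx i (spray f i) x (W x)
      + ∑ i, ∑ j, pd i (fun y => W y j) x * (2 * nonlinConn f i j x (W x))
      + ∑ i, ∑ j, W x j * pd j (fun y => W y i) x * pd i Φ x
      + ∑ i, spray f i x (W x) * pd i Φ x := by
    simp only [coordDiv, hf.pd_accel hW hx hv, hf.accel_apply hx hv, add_mul,
      Finset.sum_add_distrib, Finset.sum_mul]
    ring
  rw [hdiv, fderiv_coordDiv_self hΦ hW, trace_covDeriv_sq, hf.sprayDeriv_weightFlow hΦ hx hv]
  simp only [ricciCoord, riemannCurv, Finset.sum_add_distrib, Finset.sum_sub_distrib]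
  ring

theorem pd_energy_field (hf : IsFinslerOn O f) (hW : DifferentiableAt ℝ W x) (hx : x ∈ O)
    (hv : W x ≠ 0) (l : Fin n) : pd l (fun y => energy f y (W y)) x =
      ∑ k, covDeriv f W x k l * covec f k x (W x) := by
  rw [pd_comp_field (hf.smoothAt_energy hx hv).differentiableAt hW, hf.pdx_energy hx hv,
    ← Finset.sum_add_distrib]
  refine Finset.sum_congr rfl fun k _ => ?_
  simp only [covDeriv, Matrix.of_apply, covec]
  ring

theorem fderiv_energy_field (hf : IsFinslerOn O f) (hW : DifferentiableAt ℝ W x) (hx : x ∈ O)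
    (hv : W x ≠ 0) (b : Model n) : fderiv ℝ (fun y => energy f y (W y)) x b =
      momentum (f x) (W x) (WithLp.toLp 2 (covDeriv f W x *ᵥ b)) := by
  rw [map_eq_sum_basisVec, map_eq_sum_basisVec (momentum (f x) (W x))]
  change ∑ l, b l * pd l (fun y => energy f y (W y)) x = _
  simp only [hf.pd_energy_field hW hx hv, smul_eq_mul, Matrix.mulVec, dotProduct, Finset.mul_sum,
    Finset.sum_mul, ← covec_eq_momentum]
  rw [Finset.sum_comm]
  exact Finset.sum_congr rfl fun k _ => Finset.sum_congr rfl fun l _ => by ring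

end IsFinslerOn

namespace IsGradientOn

theorem pd_pd_potential (hW : IsGradientOn O f U W) (hf : IsFinslerOn O f) (hx : x ∈ O)
    (k l : Fin n) : pd l (pd k U) x =
      pdx l (covec f k) x (W x) + ∑ j, gLow f k j x (W x) * pd l (fun y => W y j) x := by
  have hv := hW.ne_zero x hx
  have hcovec : pd k U =ᶠ[𝓝 x] fun y => covec f k y (W y) := by
    filter_upwards [hf.isOpen.mem_nhds hx] with y hy
    rw [covec_eq_momentum, hW.momentum_eq y hy, pd]
  rw [pd_congr hcovec, pd_comp_field (hf.smoothAt_covec hx hv k).differentiableAt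
    ((hW.contDiffAt hf hx).differentiableAt (by simp))]
  simp only [← gLow_eq_pdv_covec, hf.gLow_symm hx hv _ k, mul_comm]

theorem gMatrix_mul_covDeriv_symm (hW : IsGradientOn O f U W) (hf : IsFinslerOn O f)
    (hx : x ∈ O) :
    (gMatrix (f x) (W x) * covDeriv f W x)ᵀ = gMatrix (f x) (W x) * covDeriv f W x := by
  have hentry (k l : Fin n) : (gMatrix (f x) (W x) * covDeriv f W x) k l =
      ∑ j, gLow f k j x (W x) * pd l (fun y => W y j) x +
        ∑ j, gLow f k j x (W x) * nonlinConn f j l x (W x) := by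
    rw [Matrix.mul_apply, ← Finset.sum_add_distrib]
    exact Finset.sum_congr rfl fun j _ => mul_add _ _ _
  ext l k
  have hcurl := hf.sum_gLow_mul_nonlinConn_sub_swap hx (hW.ne_zero x hx) l k
  have hcomm := pd_comm ((hW.contDiffOn_potential.contDiffAt (hf.isOpen.mem_nhds hx)).of_le
    (WithTop.coe_le_coe.mpr le_top)) l k
  rw [hW.pd_pd_potential hf hx, hW.pd_pd_potential hf hx] at hcomm
  rw [Matrix.transpose_apply, hentry, hentry]
  linarith

/-- The energy of a gradient field increases fastest along its acceleration, because its covariant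
derivative is self-adjoint. -/
theorem halfHess_accel (hW : IsGradientOn O f U W) (hf : IsFinslerOn O f) (hx : x ∈ O)
    (b : Model n) :
    halfHess (f x) (W x) (accel f W x) b = fderiv ℝ (fun y => energy f y (W y)) x b := by
  have hv := hW.ne_zero x hx
  have hmink := hf.minkowski x hx
  have hsymm := hW.gMatrix_mul_covDeriv_symm hf hx
  have hg : (gMatrix (f x) (W x))ᵀ = gMatrix (f x) (W x) :=
    Matrix.ext fun i j => hmink.gMatrix_symm hv j i
  rw [Matrix.transpose_mul, hg] at hsymm
  rw [hf.fderiv_energy_field ((hW.contDiffAt hf hx).differentiableAt (by simp)) hx hv,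
    ← hmink.halfHess_self_left hv, hmink.halfHess_eq_dotProduct hv,
    hmink.halfHess_eq_dotProduct hv]
  simp only [accel, Matrix.mulVec_mulVec, ← hsymm]
  rw [← Matrix.mulVec_mulVec, Matrix.dotProduct_mulVec (W x).ofLp, Matrix.vecMul_transpose]

/-- Since `D(F²/2) = F DF`, the acceleration is `F(W) Y`; apply the trace inequality for the
self-adjoint covariant derivative to `W`. -/
theorem fderiv_norm_le_trace (hW : IsGradientOn O f U W) (hf : IsFinslerOn O f) (hx : x ∈ O)
    {Y : Model n}
    (hY : ∀ b, halfHess (f x) (W x) Y b = fderiv ℝ (fun y => f y (W y)) x b) :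
    fderiv ℝ (fun y => f y (W y)) x Y ≤ (covDeriv f W x * covDeriv f W x).trace := by
  have hmink := hf.minkowski x hx
  have hv := hW.ne_zero x hx
  have hnorm : DifferentiableAt ℝ (fun y => f y (W y)) x :=
    ((hf.smoothAt x hx _ hv).comp_field (hW.contDiffAt hf hx)).differentiableAt (by simp)
  have henergy : HasFDerivAt (fun y => energy f y (W y))
      (f x (W x) • fderiv ℝ (fun y => f y (W y)) x) x := by
    refine ((hnorm.hasFDerivAt.pow 2).const_mul (1 / 2 : ℝ)).congr_fderiv ?_
    rw [smul_smul]
    congr 1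
    simp
  have haccel : accel f W x = f x (W x) • Y := by
    refine hmink.eq_of_halfHess_eq hv fun b => ?_
    rw [hW.halfHess_accel hf hx, henergy.fderiv, hmink.halfHess_eq hv, map_smul, smul_apply,
      smul_apply, ← hmink.halfHess_eq hv, hY]
  have haccel_sq : halfHess (f x) (W x) (accel f W x) (accel f W x) =
      f x (W x) ^ 2 * halfHess (f x) (W x) Y Y := by
    rw [haccel, hmink.halfHess_eq hv, hmink.halfHess_eq hv, map_smul, map_smul, smul_apply,
      smul_eq_mul, smul_eq_mul]
    ring
  have hself : halfHess (f x) (W x) (W x) (W x) = f x (W x) ^ 2 := by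
    rw [hmink.halfHess_self_left hv, hmink.momentum_self hv]
  have htrace : halfHess (f x) (W x) (accel f W x) (accel f W x) ≤
      (covDeriv f W x * covDeriv f W x).trace * halfHess (f x) (W x) (W x) (W x) := by
    rw [hmink.halfHess_eq_dotProduct hv, hmink.halfHess_eq_dotProduct hv]
    exact mulVec_dotProduct_le_trace (hmink.gMatrix_posDef hv)
      (hW.gMatrix_mul_covDeriv_symm hf hx) (W x)
  rw [haccel_sq, hself, mul_comm] at htrace
  rw [← hY Y]
  exact le_of_mul_le_mul_right htrace (pow_pos (hmink.pos hv) 2)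

end IsGradientOn

end CovariantDerivative

/-! ### Passage to charts -/

section Chart

variable {n : ℕ} {M : Type*} [TopologicalSpace M] [ChartedSpace (Model n) M]
  {e : OpenPartialHomeomorph M (Model n)} {y : Model n}

/-- The differential `Du(x)` as a linear form on `ℝⁿ`. -/
def dform (φ : M → ℝ) (x : M) : Model n →L[ℝ] ℝ := differential φ x

/-- The coordinate expression in the chart `e` of a vector field, whose values are read in `ℝⁿ` by
means of the definitional equality `TangentSpace (𝓡 n) x = ℝⁿ`. -/
def fieldInChart (e : OpenPartialHomeomorph M (Model n)) (V : M → Model n) (y : Model n) :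
    Model n :=
  vecInChart e (e.symm y) (V (e.symm y))

/-- The part of the chart domain, in the coordinates of `e`, where `Du ≠ 0`. -/
def regularSet (e : OpenPartialHomeomorph M (Model n)) (u : M → ℝ) : Set (Model n) :=
  e.target ∩ fderiv ℝ (u ∘ e.symm) ⁻¹' {0}ᶜ

variable [IsManifold (𝓡 n) ∞ M]

theorem mdifferentiable_chart (he : e ∈ atlas (Model n) M) : e.MDifferentiable (𝓡 n) (𝓡 n) :=
  have : IsManifold (𝓡 n) 1 M := IsManifold.of_le (n := ∞) (WithTop.coe_le_coe.2 le_top)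
  mdifferentiable_of_mem_atlas he

theorem vecInChart_ne_zero (he : e ∈ atlas (Model n) M) {x : M} (hx : x ∈ e.source)
    {v : TangentSpace (𝓡 n) x} (hv : v ≠ 0) : vecInChart e x v ≠ 0 :=
  ((mdifferentiable_chart he).mfderiv hx).map_ne_zero_iff.2 hv

theorem contMDiffOn_chart_symm (he : e ∈ atlas (Model n) M) :
    ContMDiffOn (𝓡 n) (𝓡 n) ∞ e.symm e.target :=
  contMDiffOn_symm_of_mem_maximalAtlas (IsManifold.subset_maximalAtlas he)

/-- The differential of the inverse of the chart `e` at `y`, as an isomorphism of `ℝⁿ` with the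
tangent space. -/
def chartDeriv (he : e ∈ atlas (Model n) M) (hy : y ∈ e.target) : Model n ≃L[ℝ] Model n :=
  (mdifferentiable_chart he).symm.mfderiv (x := y) hy

theorem chartDeriv_fieldInChart (he : e ∈ atlas (Model n) M) (hy : y ∈ e.target)
    (V : M → Model n) : chartDeriv he hy (fieldInChart e V y) = V (e.symm y) :=
  (chartDeriv he hy).apply_symm_apply _

theorem fieldInChart_ne_zero (he : e ∈ atlas (Model n) M) (hy : y ∈ e.target) {V : M → Model n}
    (hV : V (e.symm y) ≠ 0) : fieldInChart e V y ≠ 0 :=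
  vecInChart_ne_zero he (e.map_target hy) hV

theorem mdifferentiableAt_of_comp_chart_symm (he : e ∈ atlas (Model n) M) {φ : M → ℝ}
    (hy : y ∈ e.target) (hφ : DifferentiableAt ℝ (φ ∘ e.symm) y) :
    MDifferentiableAt (𝓡 n) 𝓘(ℝ, ℝ) φ (e.symm y) := by
  have hz : e.symm y ∈ e.source := e.map_target hy
  have hcomp : MDifferentiableAt (𝓡 n) 𝓘(ℝ, ℝ) ((φ ∘ e.symm) ∘ e) (e.symm y) :=
    MDifferentiableAt.comp _ (by rw [e.right_inv hy]; exact hφ.mdifferentiableAt)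
      ((mdifferentiable_chart he).mdifferentiableAt hz)
  refine hcomp.congr_of_eventuallyEq ?_
  filter_upwards [e.open_source.mem_nhds hz] with z hz
  simp [e.left_inv hz]

theorem fderiv_comp_chart_symm (he : e ∈ atlas (Model n) M) {φ : M → ℝ} (hy : y ∈ e.target)
    (hφ : DifferentiableAt ℝ (φ ∘ e.symm) y) (a : Model n) :
    fderiv ℝ (φ ∘ e.symm) y a = dform φ (e.symm y) (chartDeriv he hy a) := by
  rw [← mfderiv_eq_fderiv, mfderiv_comp y (mdifferentiableAt_of_comp_chart_symm he hy hφ)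
    ((mdifferentiable_chart he).mdifferentiableAt_symm hy)]
  rfl

theorem dform_field (he : e ∈ atlas (Model n) M) {φ : M → ℝ} (hy : y ∈ e.target)
    (hφ : DifferentiableAt ℝ (φ ∘ e.symm) y) (V : M → Model n) :
    dform φ (e.symm y) (V (e.symm y)) = fderiv ℝ (φ ∘ e.symm) y (fieldInChart e V y) := by
  rw [fderiv_comp_chart_symm he hy hφ, chartDeriv_fieldInChart]

theorem contDiffOn_comp_chart_symm (he : e ∈ atlas (Model n) M) {φ : M → ℝ}
    (hφ : ContMDiff (𝓡 n) 𝓘(ℝ, ℝ) ∞ φ) : ContDiffOn ℝ ∞ (φ ∘ e.symm) e.target :=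
  (hφ.comp_contMDiffOn (contMDiffOn_chart_symm he)).contDiffOn

variable {u : M → ℝ}

theorem isOpen_regularSet (he : e ∈ atlas (Model n) M) (hu : ContMDiff (𝓡 n) 𝓘(ℝ, ℝ) ∞ u) :
    IsOpen (regularSet e u) :=
  ((contDiffOn_comp_chart_symm he hu).continuousOn_fderiv_of_isOpen e.open_target
    (by simp)).isOpen_inter_preimage e.open_target isOpen_compl_singleton

theorem differentiableAt_comp_chart_symm (he : e ∈ atlas (Model n) M)
    (hu : ContMDiff (𝓡 n) 𝓘(ℝ, ℝ) ∞ u) (hy : y ∈ e.target) :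
    DifferentiableAt ℝ (u ∘ e.symm) y :=
  ((contDiffOn_comp_chart_symm he hu).contDiffAt (e.open_target.mem_nhds hy)).differentiableAt
    (by simp)

theorem dform_ne_zero_iff_mem_regularSet (he : e ∈ atlas (Model n) M)
    (hu : ContMDiff (𝓡 n) 𝓘(ℝ, ℝ) ∞ u) (hy : y ∈ e.target) :
    dform (n := n) u (e.symm y) ≠ 0 ↔ y ∈ regularSet e u := by
  have hpull : fderiv ℝ (u ∘ e.symm) y =
      (dform u (e.symm y)).comp (chartDeriv he hy : Model n →L[ℝ] Model n) :=
    ContinuousLinearMap.ext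
      (fderiv_comp_chart_symm he hy (differentiableAt_comp_chart_symm he hu hy))
  refine ⟨fun h => ⟨hy, fun h0 => h ?_⟩, fun h h0 => h.2 ?_⟩
  · refine ContinuousLinearMap.ext fun a => ?_
    have hzero := DFunLike.congr_fun (hpull.symm.trans h0) ((chartDeriv he hy).symm a)
    simpa using hzero
  · rw [Set.mem_singleton_iff, hpull, h0, ContinuousLinearMap.zero_comp]

theorem chartAt_mem_regularSet {x : M} (hu : ContMDiff (𝓡 n) 𝓘(ℝ, ℝ) ∞ u)
    (hx : dform (n := n) u x ≠ 0) :
    chartAt (Model n) x x ∈ regularSet (chartAt (Model n) x) u := by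
  rw [← dform_ne_zero_iff_mem_regularSet (chart_mem_atlas _ x) hu (mem_chart_target _ x),
    (chartAt (Model n) x).left_inv (mem_chart_source _ x)]
  exact hx

end Chart

namespace FinslerStructure

variable {n : ℕ} {M : Type*} [TopologicalSpace M] [ChartedSpace (Model n) M]
  [IsManifold (𝓡 n) ∞ M] (F : FinslerStructure n M) {e : OpenPartialHomeomorph M (Model n)}
  {y : Model n}

/-- The Finsler norm of `TₓM` as a function on `ℝⁿ`. -/
def fibreNorm (x : M) : Model n → ℝ := F.toFun x

/-- The gradient vector field as a map into `ℝⁿ`. -/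
def grad (u : M → ℝ) (x : M) : Model n := F.gradient u x

/-- The gradient of `φ` linearized at `∇u`, as a map into `ℝⁿ`. -/
def linGrad (u φ : M → ℝ) (x : M) : Model n := F.linGradient (F.gradient u) φ x

theorem inChart_eq (he : e ∈ atlas (Model n) M) (hy : y ∈ e.target) :
    F.inChart e y = fun w => F.fibreNorm (e.symm y) (chartDeriv he hy w) := rfl

theorem smoothAt_inChart (he : e ∈ atlas (Model n) M) (hy : y ∈ e.target) {w : Model n}
    (hw : w ≠ 0) : SmoothAt (F.inChart e) y w := by
  let S : Set (TangentBundle (𝓡 n) (Model n)) := {p | p.1 ∈ e.target ∧ p.2 ≠ 0}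
  have hderiv : ∀ z ∈ e.target,
      mfderivWithin (𝓡 n) (𝓡 n) e.symm e.target z = mfderiv (𝓡 n) (𝓡 n) e.symm z :=
    fun z hz => mfderivWithin_of_isOpen e.open_target hz
  have hbundle : ContMDiffOn (𝓡 n).tangent 𝓘(ℝ, ℝ) ∞
      ((fun p : TangentBundle (𝓡 n) M => F.toFun p.1 p.2) ∘
        tangentMapWithin (𝓡 n) (𝓡 n) e.symm e.target) S := by
    have htangent := (contMDiffOn_chart_symm he).contMDiffOn_tangentMapWithin (m := ∞) (by simp)
      e.open_target.uniqueMDiffOn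
    refine F.smooth.comp (htangent.mono fun p hp => hp.1) fun p hp => ?_
    change (mfderivWithin (𝓡 n) (𝓡 n) e.symm e.target p.1) p.2 ≠ 0
    rw [hderiv p.1 hp.1]
    exact (chartDeriv he hp.1).map_ne_zero_iff.2 hp.2
  have hcoord : ContMDiffOn (𝓡 n).tangent 𝓘(ℝ, ℝ) ∞
      (fun q : ModelProd (Model n) (Model n) => F.inChart e q.1 q.2)
      {q | q.1 ∈ e.target ∧ q.2 ≠ 0} := by
    have htriv : ContMDiff (𝓡 n).tangent (𝓡 n).tangent ∞
        (tangentBundleModelSpaceHomeomorph (𝓡 n) (H := Model n)).symm :=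
      contMDiff_tangentBundleModelSpaceHomeomorph_symm
    refine (hbundle.comp htriv.contMDiffOn fun q hq => hq).congr fun q hq => ?_
    change F.toFun (e.symm q.1) (mfderiv 𝓘(ℝ, Model n) (𝓡 n) e.symm q.1 q.2) =
      F.toFun (e.symm q.1) (mfderivWithin (𝓡 n) (𝓡 n) e.symm e.target q.1 q.2)
    rw [hderiv q.1 hq.1]
  have hdiff : ContDiffOn ℝ ∞ (Function.uncurry (F.inChart e)) (e.target ×ˢ {0}ᶜ) := by
    rw [← contMDiffOn_iff_contDiffOn, modelWithCornersSelf_prod]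
    exact hcoord
  exact hdiff.contDiffAt ((e.open_target.prod isOpen_compl_singleton).mem_nhds ⟨hy, hw⟩)

theorem isMinkowskiNorm (x : M) : IsMinkowskiNorm (F.fibreNorm x) where
  nonneg := F.nonneg x
  homogeneous := F.homogeneous x
  halfHess_pos := F.stronglyConvex x
  contDiffOn v hv := by
    set e := chartAt (Model n) x
    have he : e ∈ atlas (Model n) M := chart_mem_atlas (Model n) x
    have hy : e x ∈ e.target := mem_chart_target (Model n) x
    let L := chartDeriv he hy
    have hfibre : F.fibreNorm x = fun w => F.inChart e (e x) (L.symm w) := by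
      rw [F.inChart_eq he hy, e.left_inv (mem_chart_source _ x)]
      simp [L]
    have hL : ContDiffAt ℝ ∞ (fun w => (e x, L.symm w)) v :=
      contDiffAt_const.prodMk L.symm.contDiff.contDiffAt
    rw [hfibre]
    have hLv : L.symm v ≠ 0 := L.symm.map_ne_zero_iff.2 hv
    exact (ContDiffAt.comp (g := Function.uncurry (F.inChart e))
      (f := fun w => (e x, L.symm w)) v (F.smoothAt_inChart he hy hLv) hL).contDiffWithinAt

theorem isFinslerOn_inChart (he : e ∈ atlas (Model n) M) :
    IsFinslerOn e.target (F.inChart e) where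
  isOpen := e.open_target
  smoothAt _ hy _ hv := F.smoothAt_inChart he hy hv
  minkowski y hy := (F.isMinkowskiNorm (e.symm y)).comp (chartDeriv he hy)

theorem grad_spec {u : M → ℝ} {x : M} (hx : dform (n := n) u x ≠ 0) :
    F.grad u x ≠ 0 ∧ momentum (F.fibreNorm x) (F.grad u x) = dform u x := by
  obtain ⟨hexists, hunique⟩ := (F.isMinkowskiNorm x).legendre_spec hx rfl
  have hgrad := Classical.epsilon_spec hexists
  exact hunique _ hgrad.1 hgrad.2

theorem inChart_fieldInChart (he : e ∈ atlas (Model n) M) (hy : y ∈ e.target) (V : M → Model n) :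
    F.inChart e y (fieldInChart e V y) = F.fibreNorm (e.symm y) (V (e.symm y)) := by
  simp only [F.inChart_eq he hy, chartDeriv_fieldInChart he hy]

theorem halfHess_inChart (he : e ∈ atlas (Model n) M) (hy : y ∈ e.target) (V : M → Model n)
    (a b : Model n) : halfHess (F.inChart e y) (fieldInChart e V y) a b =
      halfHess (F.fibreNorm (e.symm y)) (V (e.symm y)) (chartDeriv he hy a)
        (chartDeriv he hy b) := by
  rw [F.inChart_eq he hy, halfHess_comp, chartDeriv_fieldInChart he hy]

theorem momentum_inChart (he : e ∈ atlas (Model n) M) (hy : y ∈ e.target) (V : M → Model n)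
    (a : Model n) : momentum (F.inChart e y) (fieldInChart e V y) a =
      momentum (F.fibreNorm (e.symm y)) (V (e.symm y)) (chartDeriv he hy a) := by
  rw [F.inChart_eq he hy, momentum_comp, chartDeriv_fieldInChart he hy]

open scoped Matrix in
theorem halfHess_linGrad {u : M → ℝ} {x : M} (hV : F.grad u x ≠ 0) (φ : M → ℝ) (b : Model n) :
    halfHess (F.fibreNorm x) (F.grad u x) (F.linGrad u φ x) b = dform φ x b := by
  have hmink := F.isMinkowskiNorm x
  set g := gMatrix (F.fibreNorm x) (F.grad u x)
  have hunit : IsUnit g.det := isUnit_iff_ne_zero.2 (hmink.gMatrix_posDef hV).det_pos.ne'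
  have hgX : g *ᵥ (F.linGrad u φ x).ofLp = fun j => dform φ x (basisVec j) := by
    have hX : (F.linGrad u φ x).ofLp = g⁻¹ *ᵥ fun j => dform φ x (basisVec j) := by
      ext i
      change (∑ i : Fin n, (∑ j : Fin n, g⁻¹ i j * dform φ x (basisVec j)) •
        (basisVec i : Model n)) i = _
      simp [basisVec_apply, Matrix.mulVec, dotProduct]
    rw [hX, Matrix.mulVec_mulVec, Matrix.mul_nonsing_inv _ hunit, Matrix.one_mulVec]
  rw [hmink.halfHess_symm hV, hmink.halfHess_eq_dotProduct hV, hgX, map_eq_sum_basisVec]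
  rfl

variable {u : M → ℝ}

theorem isFinslerOn_regularSet (he : e ∈ atlas (Model n) M) (hu : ContMDiff (𝓡 n) 𝓘(ℝ, ℝ) ∞ u) :
    IsFinslerOn (regularSet e u) (F.inChart e) :=
  (F.isFinslerOn_inChart he).mono (isOpen_regularSet he hu) Set.inter_subset_left

theorem isGradientOn_grad (he : e ∈ atlas (Model n) M) (hu : ContMDiff (𝓡 n) 𝓘(ℝ, ℝ) ∞ u) :
    IsGradientOn (regularSet e u) (F.inChart e) (u ∘ e.symm) (fieldInChart e (F.grad u)) where
  contDiffOn_potential := (contDiffOn_comp_chart_symm he hu).mono Set.inter_subset_left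
  ne_zero y hy := fieldInChart_ne_zero he hy.1
    (F.grad_spec ((dform_ne_zero_iff_mem_regularSet he hu hy.1).2 hy)).1
  momentum_eq y hy := ContinuousLinearMap.ext fun a => by
    rw [F.momentum_inChart he hy.1,
      (F.grad_spec ((dform_ne_zero_iff_mem_regularSet he hu hy.1).2 hy)).2,
      fderiv_comp_chart_symm he hy.1 (differentiableAt_comp_chart_symm he hu hy.1)]

theorem halfHess_linGrad_inChart (he : e ∈ atlas (Model n) M) (hu : ContMDiff (𝓡 n) 𝓘(ℝ, ℝ) ∞ u)
    (hy : y ∈ regularSet e u) {φ : M → ℝ} (hφ : DifferentiableAt ℝ (φ ∘ e.symm) y)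
    (b : Model n) : halfHess (F.inChart e y) (fieldInChart e (F.grad u) y)
      (fieldInChart e (F.linGrad u φ) y) b = fderiv ℝ (φ ∘ e.symm) y b := by
  have hgrad := (F.grad_spec ((dform_ne_zero_iff_mem_regularSet he hu hy.1).2 hy)).1
  rw [F.halfHess_inChart he hy.1, chartDeriv_fieldInChart he hy.1, F.halfHess_linGrad hgrad,
    fderiv_comp_chart_symm he hy.1 hφ]

end FinslerStructure

/-! ### Geodesics -/

theorem IsFinslerOn.exists_geodesic {n : ℕ} {O : Set (Model n)} {f : Model n → Model n → ℝ}
    {x v : Model n} (hf : IsFinslerOn O f) (hx : x ∈ O) (hv : v ≠ 0) :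
    ∃ c w : ℝ → Model n, c 0 = x ∧ w 0 = v ∧ (∀ᶠ t in 𝓝 0, HasDerivAt c (w t) t) ∧
      ∀ᶠ t in 𝓝 0, ∀ i, HasDerivAt (fun s => w s i) (-spray f i (c t) (w t)) t := by
  let Y : Model n × Model n → Model n × Model n :=
    fun q => (q.2, WithLp.toLp 2 fun i => -spray f i q.1 q.2)
  have hY : ContDiffAt ℝ 1 Y (x, v) := by
    refine contDiffAt_snd.prodMk (contDiffAt_euclidean.2 fun i => ?_)
    exact (hf.smoothAt_spray hx hv i).neg.of_le (WithTop.coe_le_coe.2 le_top)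
  obtain ⟨α, hα0, ε, hε, hα⟩ :=
    hY.exists_forall_mem_closedBall_exists_eq_forall_mem_Ioo_hasDerivAt₀ 0
  have hflow : ∀ᶠ t in 𝓝 (0 : ℝ), HasDerivAt α (Y (α t)) t := by
    filter_upwards [Ioo_mem_nhds (show 0 - ε < 0 by linarith) (show 0 < 0 + ε by linarith)]
      with t ht using hα t ht
  refine ⟨fun t => (α t).1, fun t => (α t).2, by simp [hα0], by simp [hα0], ?_, ?_⟩
  · filter_upwards [hflow] with t ht
    exact (ContinuousLinearMap.fst ℝ (Model n) (Model n)).hasFDerivAt.comp_hasDerivAt t ht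
  · filter_upwards [hflow] with t ht i
    exact ((EuclideanSpace.proj i : Model n →L[ℝ] ℝ).comp
      (ContinuousLinearMap.snd ℝ (Model n) (Model n))).hasFDerivAt.comp_hasDerivAt t ht

namespace FinslerStructure

variable {n : ℕ} {M : Type*} [TopologicalSpace M] [ChartedSpace (Model n) M]
  [IsManifold (𝓡 n) ∞ M] (F : FinslerStructure n M) {x : M} {v : TangentSpace (𝓡 n) x}

theorem isGeodesicAt_of_coord {c w : ℝ → Model n} (hc0 : c 0 = chartAt (Model n) x x)
    (hw0 : w 0 = vecInChart (chartAt (Model n) x) x v)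
    (hc : ∀ᶠ t in 𝓝 0, HasDerivAt c (w t) t)
    (hw : ∀ᶠ t in 𝓝 0, ∀ i, HasDerivAt (fun s => w s i)
      (-spray (F.inChart (chartAt (Model n) x)) i (c t) (w t)) t) :
    F.IsGeodesicAt x v fun t => (chartAt (Model n) x).symm (c t) := by
  set e := chartAt (Model n) x
  have hx : x ∈ e.source := mem_chart_source _ x
  have htarget : ∀ᶠ t in 𝓝 (0 : ℝ), c t ∈ e.target :=
    hc.self_of_nhds.continuousAt.eventually_mem
      (by rw [hc0]; exact e.open_target.mem_nhds (e.map_source hx))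
  have hcoord : ∀ᶠ t in 𝓝 (0 : ℝ), e (e.symm (c t)) = c t :=
    htarget.mono fun t ht => e.right_inv ht
  have hvel : ∀ᶠ t in 𝓝 (0 : ℝ), HasDerivAt (fun s => e (e.symm (c s))) (w t) t := by
    filter_upwards [hcoord.eventually_nhds, hc] with t ht hct using hct.congr_of_eventuallyEq ht
  have hderiv : ∀ᶠ t in 𝓝 (0 : ℝ), deriv (fun s => e (e.symm (c s))) t = w t :=
    hvel.mono fun t ht => ht.deriv
  refine ⟨by simp only [hc0, e.left_inv hx], htarget.mono fun t ht => e.map_target ht,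
    hw0 ▸ hvel.self_of_nhds, hvel.mono fun t ht => ht.differentiableAt, ?_⟩
  filter_upwards [hderiv.eventually_nhds, hcoord, hw] with t hnear ht hacc i
  have hi : (fun s => deriv (fun r => e (e.symm (c r))) s i) =ᶠ[𝓝 t] fun s => w s i :=
    hnear.mono fun s hs => congrArg (fun z : Model n => z i) hs
  rw [ht, hnear.self_of_nhds]
  exact (hacc i).congr_of_eventuallyEq hi

theorem isGeodesicAt_geodesic (hv : v ≠ 0) : F.IsGeodesicAt x v (F.geodesic x v) := by
  have : Nonempty M := ⟨x⟩
  obtain ⟨c, w, hc0, hw0, hc, hw⟩ := (F.isFinslerOn_inChart (chart_mem_atlas (Model n) x)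
    ).exists_geodesic (mem_chart_target (Model n) x)
      (vecInChart_ne_zero (chart_mem_atlas (Model n) x) (mem_chart_source (Model n) x) hv)
  exact Classical.epsilon_spec (p := F.IsGeodesicAt x v)
    ⟨_, F.isGeodesicAt_of_coord hc0 hw0 hc hw⟩

theorem IsGeodesicAt.eventually_velocity_ne_zero {F : FinslerStructure n M} {η : ℝ → M}
    (hη : F.IsGeodesicAt x v η) (hv : v ≠ 0) :
    ∀ᶠ t in 𝓝 0, deriv (fun s => chartAt (Model n) x (η s)) t ≠ 0 := by
  have hcoord : ContinuousAt
      (fun t => (deriv (fun s => chartAt (Model n) x (η s)) t).ofLp) 0 :=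
    continuousAt_pi.2 fun i => (hη.equation.self_of_nhds i).continuousAt
  have hcont : ContinuousAt (deriv fun s => chartAt (Model n) x (η s)) 0 :=
    (PiLp.continuous_toLp 2 fun _ : Fin n => ℝ).continuousAt.comp hcoord
  refine hcont.eventually_ne ?_
  rw [hη.velocity.deriv]
  exact vecInChart_ne_zero (chart_mem_atlas (Model n) x) (mem_chart_source (Model n) x) hv

theorem deriv_deriv_weightAlong [MeasurableSpace M] {m : MeasureTheory.Measure M}
    {η : ℝ → M} (hη : F.IsGeodesicAt x v η) (hv : v ≠ 0)
    (hΦ : ContDiffOn ℝ ∞ (logDensity m (chartAt (Model n) x)) (chartAt (Model n) x).target) :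
    deriv (deriv (F.weightAlong m x η)) 0 =
      sprayDeriv (F.inChart (chartAt (Model n) x))
        (weightFlow (F.inChart (chartAt (Model n) x)) (logDensity m (chartAt (Model n) x)))
        (chartAt (Model n) x x) (vecInChart (chartAt (Model n) x) x v) := by
  set e := chartAt (Model n) x
  set f := F.inChart e
  set Φ := logDensity m e
  have hf : IsFinslerOn e.target f := F.isFinslerOn_inChart (chart_mem_atlas (Model n) x)
  have hΦat : ∀ y ∈ e.target, ContDiffAt ℝ ∞ Φ y := fun y hy =>
    hΦ.contDiffAt (e.open_target.mem_nhds hy)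
  let c : ℝ → Model n := fun s => e (η s)
  let w : ℝ → Model n := deriv c
  have hc0 : c 0 = e x := congrArg e hη.start
  have hw0 : w 0 = vecInChart e x v := hη.velocity.deriv
  have hc : ∀ᶠ t in 𝓝 (0 : ℝ), HasDerivAt c (w t) t :=
    hη.differentiable.mono fun t ht => ht.hasDerivAt
  have hw : ∀ᶠ t in 𝓝 (0 : ℝ), ∀ i, HasDerivAt (fun s => w s i) (-spray f i (c t) (w t)) t :=
    hη.equation
  have htarget : ∀ᶠ t in 𝓝 (0 : ℝ), c t ∈ e.target :=
    hη.mem_source.mono fun t ht => e.map_source ht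
  have hw_ne : ∀ᶠ t in 𝓝 (0 : ℝ), w t ≠ 0 := hη.eventually_velocity_ne_zero hv
  have hfirst : deriv (F.weightAlong m x η) =ᶠ[𝓝 0] fun t => weightFlow f Φ (c t) (w t) := by
    filter_upwards [hc, hw, htarget, hw_ne] with t hct hwt ht hne
    rw [← hf.sprayDeriv_weightCoord (hΦat _ ht) ht hne]
    exact (hasDerivAt_along_geodesic
      (hf.smoothAt_weightCoord (hΦat _ ht) ht hne).differentiableAt hct hwt).deriv
  have hx := htarget.self_of_nhds
  rw [hfirst.deriv_eq, ← hc0, ← hw0]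
  exact (hasDerivAt_along_geodesic (hf.smoothAt_weightFlow (hΦat _ hx) hx
    hw_ne.self_of_nhds).differentiableAt hc.self_of_nhds hw.self_of_nhds).deriv

end FinslerStructure

/-! ### Invariance of the divergence under coordinate changes -/

section ChangeOfVariables

theorem hasFDerivAt_log_abs_det {E : Type*} [NormedAddCommGroup E] [NormedSpace ℝ E]
    [FiniteDimensional ℝ E] (A : E ≃L[ℝ] E) :
    HasFDerivAt (fun L : E →L[ℝ] E => Real.log |L.det|)
      (LinearMap.toContinuousLinearMap (LinearMap.trace ℝ E ∘ₗ ContinuousLinearMap.coeLM ℝ ∘ₗ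
        (ContinuousLinearMap.compL ℝ E E E A.symm).toLinearMap)) (A : E →L[ℝ] E) := by
  let b := Module.finBasis ℝ E
  let matrix : (E →L[ℝ] E) →ₗ[ℝ] Matrix _ _ ℝ :=
    (LinearMap.toMatrix b b).toLinearMap ∘ₗ ContinuousLinearMap.coeLM ℝ
  have hdet (L : E →L[ℝ] E) : (matrix L).det = L.det := LinearMap.det_toMatrix b _
  have hA : (matrix A).det ≠ 0 := by
    rw [hdet]
    exact (LinearEquiv.isUnit_det' A.toLinearEquiv).ne_zero
  have hinv : matrix A.symm = (matrix A)⁻¹ := by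
    refine (Matrix.inv_eq_left_inv ?_).symm
    refine (LinearMap.toMatrix_comp b b b _ _).symm.trans ?_
    rw [← LinearMap.toMatrix_id b]
    exact congrArg _ (LinearMap.ext A.symm_apply_apply)
  have hentry (i j) : HasFDerivAt (fun L => matrix L i j)
      (LinearMap.toContinuousLinearMap (Matrix.entryLinearMap ℝ ℝ i j ∘ₗ matrix)) (A : E →L[ℝ] E) :=
    (LinearMap.toContinuousLinearMap (Matrix.entryLinearMap ℝ ℝ i j ∘ₗ matrix)).hasFDerivAt
  refine (((hasFDerivAt_matrix_det hentry).log hA).congr_fderiv ?_).congr_of_eventuallyEq ?_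
  · ext B
    have htrace : LinearMap.trace ℝ E (A.symm.toContinuousLinearMap ∘L B) =
        ((matrix A)⁻¹ * matrix B).trace := by
      rw [LinearMap.trace_eq_matrix_trace ℝ b, ← hinv]
      exact congrArg Matrix.trace (LinearMap.toMatrix_comp b b b _ _)
    refine Eq.trans ?_ htrace.symm
    rw [Matrix.inv_def, Ring.inverse_eq_inv', Matrix.smul_mul, Matrix.trace_smul]
    simp only [smul_apply, sum_apply, smul_eq_mul, Matrix.trace, Matrix.diag, Matrix.mul_apply]
    rw [Finset.sum_comm]
    rfl
  · exact .of_forall fun L => by simp only [hdet, Real.log_abs]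

variable {n : ℕ} {τ W W' : Model n → Model n} {Φ Φ' : Model n → ℝ} {x : Model n}

theorem coordDiv_eq_trace (hW : DifferentiableAt ℝ W x) :
    coordDiv Φ W x = LinearMap.trace ℝ (Model n) (fderiv ℝ W x) + fderiv ℝ Φ x (W x) := by
  have hcoord (i : Fin n) : pd i (fun y => W y i) x = fderiv ℝ W x (basisVec i) i :=
    DFunLike.congr_fun ((EuclideanSpace.proj i : Model n →L[ℝ] ℝ).hasFDerivAt.comp x
      hW.hasFDerivAt).fderiv (basisVec i)
  rw [LinearMap.trace_eq_matrix_trace ℝ (EuclideanSpace.basisFun (Fin n) ℝ).toBasis,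
    map_eq_sum_basisVec, coordDiv, Finset.sum_add_distrib]
  simp only [Matrix.trace, Matrix.diag, LinearMap.toMatrix_apply, hcoord]
  simp [basisVec, pd]

theorem differentiableAt_of_fderiv_apply_eq {A : Model n ≃L[ℝ] Model n} (hτ : ContDiffAt ℝ 2 τ x)
    (hA : fderiv ℝ τ x = A) (hW : DifferentiableAt ℝ W (τ x))
    (hWW' : ∀ᶠ y in 𝓝 x, fderiv ℝ τ y (W' y) = W (τ y)) : DifferentiableAt ℝ W' x := by
  have hdτ : ContDiffAt ℝ 1 (fderiv ℝ τ) x := hτ.fderiv_right (by norm_num)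
  have hinv : DifferentiableAt ℝ (fun y => (fderiv ℝ τ y).inverse) x := by
    refine DifferentiableAt.comp x (g := ContinuousLinearMap.inverse) ?_
      (hdτ.differentiableAt (by simp))
    rw [hA]
    exact (contDiffAt_map_inverse (n := 1) A).differentiableAt (by simp)
  refine (hinv.clm_apply (hW.comp x (hτ.differentiableAt (by simp)))).congr_of_eventuallyEq ?_
  have hequiv := hdτ.continuousAt.eventually (hA ▸ A.nhds)
  filter_upwards [hWW', hequiv] with y hy ⟨B, hB⟩
  rw [Function.comp_apply, ← hy, ← hB, ContinuousLinearMap.inverse_equiv]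
  simp

/-- Differentiating `Dτ(W') = W ∘ τ` shows that `tr DW'` and `tr DW` differ by
`tr (Dτ⁻¹ D²τ(W', ·))`, which is the derivative of `log |det Dτ|` along `W'`. -/
theorem coordDiv_change {A : Model n ≃L[ℝ] Model n} (hτ : ContDiffAt ℝ 2 τ x)
    (hA : fderiv ℝ τ x = A) (hW : DifferentiableAt ℝ W (τ x)) (hΦ : DifferentiableAt ℝ Φ (τ x))
    (hWW' : ∀ᶠ y in 𝓝 x, fderiv ℝ τ y (W' y) = W (τ y))
    (hΦ' : ∀ᶠ y in 𝓝 x, Φ' y = Φ (τ y) + Real.log |(fderiv ℝ τ y).det|) :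
    coordDiv Φ' W' x = coordDiv Φ W (τ x) := by
  have hW' := differentiableAt_of_fderiv_apply_eq hτ hA hW hWW'
  have hτx : HasFDerivAt τ (A : Model n →L[ℝ] Model n) x :=
    hA ▸ (hτ.differentiableAt (by simp)).hasFDerivAt
  have hDτ : HasFDerivAt (fderiv ℝ τ) (fderiv ℝ (fderiv ℝ τ) x) x :=
    ((hτ.fderiv_right (m := 1) (by norm_num)).differentiableAt (by simp)).hasFDerivAt
  set D := fderiv ℝ (fderiv ℝ τ) x
  have hsymm (a : Model n) : D a (W' x) = D (W' x) a :=
    hτ.isSymmSndFDerivAt (by simp) a (W' x)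
  have hfield (a : Model n) : A (fderiv ℝ W' x a) + D (W' x) a = fderiv ℝ W (τ x) (A a) := by
    have hleft := hDτ.clm_apply hW'.hasFDerivAt
    have hright := hW.hasFDerivAt.comp x hτx
    have heq := DFunLike.congr_fun ((hleft.congr_of_eventuallyEq
      (hWW'.mono fun y hy => hy.symm)).unique hright) a
    simpa [hA, hsymm] using heq
  have htrace : LinearMap.trace ℝ (Model n) (fderiv ℝ W (τ x)) =
      LinearMap.trace ℝ (Model n) (fderiv ℝ W' x) +
        LinearMap.trace ℝ (Model n) (A.symm.toContinuousLinearMap ∘L D (W' x)) := by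
    rw [← LinearMap.trace_conj' (fderiv ℝ W (τ x) : Model n →ₗ[ℝ] Model n) A.symm.toLinearEquiv,
      ← map_add]
    congr 1
    ext1 a
    simp [LinearEquiv.conj_apply, ← hfield]
  have hdensity : fderiv ℝ Φ' x (W' x) = fderiv ℝ Φ (τ x) (W (τ x)) +
      LinearMap.trace ℝ (Model n) (A.symm.toContinuousLinearMap ∘L D (W' x)) := by
    have hlog := (hA.symm ▸ hasFDerivAt_log_abs_det A :
      HasFDerivAt (fun L : Model n →L[ℝ] Model n => Real.log |L.det|) _ (fderiv ℝ τ x)).comp x hDτ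
    rw [(((hΦ.hasFDerivAt.comp x hτx).add hlog).congr_of_eventuallyEq hΦ').fderiv,
      ← hWW'.self_of_nhds, hA]
    rfl
  rw [coordDiv_eq_trace hW', coordDiv_eq_trace hW, hdensity, htrace]
  ring

end ChangeOfVariables

section Transition

variable {n : ℕ} {M : Type*} [TopologicalSpace M] [ChartedSpace (Model n) M]
  [IsManifold (𝓡 n) ∞ M] {e e' : OpenPartialHomeomorph M (Model n)} {y : Model n}

theorem contDiffOn_transition (he : e ∈ atlas (Model n) M) (he' : e' ∈ atlas (Model n) M) :
    ContDiffOn ℝ ∞ (e'.symm ≫ₕ e) (e'.symm ≫ₕ e).source :=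
  ((contMDiffOn_of_mem_maximalAtlas (IsManifold.subset_maximalAtlas he)).comp
    ((contMDiffOn_chart_symm he').mono Set.inter_subset_left) fun _ hy => hy.2).contDiffOn

theorem contDiffAt_transition (he : e ∈ atlas (Model n) M) (he' : e' ∈ atlas (Model n) M)
    (hy : y ∈ (e'.symm ≫ₕ e).source) : ContDiffAt ℝ ∞ (e'.symm ≫ₕ e) y :=
  (contDiffOn_transition he he').contDiffAt ((e'.symm ≫ₕ e).open_source.mem_nhds hy)

/-- The Jacobian at `y` of the coordinate change from `e'` to `e`. -/
def transitionDeriv (he : e ∈ atlas (Model n) M) (he' : e' ∈ atlas (Model n) M)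
    (hy : y ∈ (e'.symm ≫ₕ e).source) : Model n ≃L[ℝ] Model n :=
  ((mdifferentiable_chart he').symm.trans (mdifferentiable_chart he)).mfderiv hy

theorem fderiv_transition (he : e ∈ atlas (Model n) M) (he' : e' ∈ atlas (Model n) M)
    (hy : y ∈ (e'.symm ≫ₕ e).source) :
    fderiv ℝ (e'.symm ≫ₕ e) y = transitionDeriv he he' hy :=
  mfderiv_eq_fderiv.symm

theorem fderiv_transition_fieldInChart (he : e ∈ atlas (Model n) M) (he' : e' ∈ atlas (Model n) M)
    (hy : y ∈ (e'.symm ≫ₕ e).source) (V : M → Model n) :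
    fderiv ℝ (e'.symm ≫ₕ e) y (fieldInChart e' V y) = fieldInChart e V ((e'.symm ≫ₕ e) y) := by
  have hcomp := mfderiv_comp y ((mdifferentiable_chart he).mdifferentiableAt hy.2)
    ((mdifferentiable_chart he').mdifferentiableAt_symm hy.1)
  have hpoint : e.symm ((e'.symm ≫ₕ e) y) = e'.symm y := e.left_inv hy.2
  rw [← mfderiv_eq_fderiv, fieldInChart, fieldInChart, hpoint]
  refine (DFunLike.congr_fun hcomp _).trans ?_
  exact congrArg (mfderiv (𝓡 n) 𝓘(ℝ, Model n) e (e'.symm y))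
    (chartDeriv_fieldInChart he' hy.1 V)

end Transition

section Density

theorem measurableSet_symm_image {X Y : Type*} [TopologicalSpace X] [MeasurableSpace X]
    [BorelSpace X] [TopologicalSpace Y] [MeasurableSpace Y] [BorelSpace Y]
    (e : OpenPartialHomeomorph X Y) {T : Set Y} (hT : MeasurableSet T) (hTe : T ⊆ e.target) :
    MeasurableSet (e.symm '' T) := by
  rw [e.symm_image_eq_source_inter_preimage hTe, ← Subtype.image_preimage_coe]
  exact e.open_source.measurableSet.subtype_image (e.continuousOn.domRestrict.measurable hT)

open MeasureTheory in
theorem eqOn_of_forall_setLIntegral_eq {X : Type*} [TopologicalSpace X] [MeasurableSpace X]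
    [BorelSpace X] {μ : Measure X} [SigmaFinite μ] [μ.IsOpenPosMeasure] {O : Set X}
    (hO : IsOpen O) {p q : X → ENNReal} (hp : ContinuousOn p O) (hq : ContinuousOn q O)
    (h : ∀ T ⊆ O, MeasurableSet T → ∫⁻ y in T, p y ∂μ = ∫⁻ y in T, q y ∂μ) : Set.EqOn p q O := by
  refine Measure.eqOn_open_of_ae_eq (μ := μ) ?_ hO hp hq
  refine ae_eq_of_forall_setLIntegral_eq_of_sigmaFinite₀ (hp.aemeasurable hO.measurableSet)
    (hq.aemeasurable hO.measurableSet) fun T hT _ => ?_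
  rw [Measure.restrict_restrict hT]
  exact h _ Set.inter_subset_right (hT.inter hO.measurableSet)

variable {n : ℕ} {M : Type*} [TopologicalSpace M] [ChartedSpace (Model n) M] [MeasurableSpace M]
  {e e' : OpenPartialHomeomorph M (Model n)} {m : MeasureTheory.Measure M} {y : Model n}

theorem isLogDensity_logDensity (hm : IsSmoothPositiveMeasure n m)
    (he : e ∈ atlas (Model n) M) : IsLogDensity m e (logDensity m e) :=
  Classical.epsilon_spec (hm e he)

theorem contDiffAt_logDensity (hm : IsSmoothPositiveMeasure n m) (he : e ∈ atlas (Model n) M)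
    (hy : y ∈ e.target) : ContDiffAt ℝ ∞ (logDensity m e) y :=
  (isLogDensity_logDensity hm he).1.contDiffAt (e.open_target.mem_nhds hy)

variable [BorelSpace M] [IsManifold (𝓡 n) ∞ M]

theorem setLIntegral_logDensity_change (he : e ∈ atlas (Model n) M) (he' : e' ∈ atlas (Model n) M)
    {Φ Φ' : Model n → ℝ} (hΦ : IsLogDensity m e Φ) (hΦ' : IsLogDensity m e' Φ')
    {T : Set (Model n)} (hTO : T ⊆ (e'.symm ≫ₕ e).source) (hT : MeasurableSet T) :
    ∫⁻ y in T, ENNReal.ofReal (Real.exp (Φ' y)) =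
      ∫⁻ y in T, ENNReal.ofReal
        (|(fderiv ℝ (e'.symm ≫ₕ e) y).det| * Real.exp (Φ ((e'.symm ≫ₕ e) y))) := by
  have hTe' : T ⊆ e'.target := fun y hy => (hTO hy).1
  have hS : MeasurableSet (e'.symm '' T) := measurableSet_symm_image e' hT hTe'
  have himage' : e' '' (e'.symm '' T) = T :=
    (Set.LeftInvOn.mono (fun y hy => e'.right_inv hy) hTe').image_image
  have himage : e '' (e'.symm '' T) = (e'.symm ≫ₕ e) '' T := Set.image_image _ _ _
  have hmeasure' := hΦ'.2 _ hS (Set.image_subset_iff.2 fun y hy => e'.map_target (hTe' hy))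
  have hmeasure := hΦ.2 _ hS (Set.image_subset_iff.2 fun y hy => (hTO hy).2)
  rw [himage'] at hmeasure'
  rw [himage, MeasureTheory.lintegral_image_eq_lintegral_abs_det_fderiv_mul _ hT
    (fun y hy => ((contDiffAt_transition he he' (hTO hy)).differentiableAt
      (by simp)).hasFDerivAt.hasFDerivWithinAt)
    ((e'.symm ≫ₕ e).injOn.mono hTO)] at hmeasure
  simp only [ENNReal.ofReal_mul (abs_nonneg _)]
  exact hmeasure'.symm.trans hmeasure

theorem logDensity_change (hm : IsSmoothPositiveMeasure n m) (he : e ∈ atlas (Model n) M)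
    (he' : e' ∈ atlas (Model n) M) (hy : y ∈ (e'.symm ≫ₕ e).source) :
    logDensity m e' y = logDensity m e ((e'.symm ≫ₕ e) y) +
      Real.log |(fderiv ℝ (e'.symm ≫ₕ e) y).det| := by
  have hΦ := isLogDensity_logDensity hm he
  have hΦ' := isLogDensity_logDensity hm he'
  set τ := e'.symm ≫ₕ e
  have hτ : ContDiffOn ℝ ∞ τ τ.source := contDiffOn_transition he he'
  have hmaps : Set.MapsTo τ τ.source e.target := fun z hz => e.map_source hz.2
  have hcont' : ContinuousOn (fun z => Real.exp (logDensity m e' z)) τ.source :=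
    (hΦ'.1.continuousOn.mono Set.inter_subset_left).rexp
  have hcont : ContinuousOn
      (fun z => |(fderiv ℝ τ z).det| * Real.exp (logDensity m e (τ z))) τ.source :=
    (ContinuousLinearMap.continuous_det.comp_continuousOn
      (hτ.continuousOn_fderiv_of_isOpen τ.open_source (by simp))).abs.mul
      (hΦ.1.continuousOn.comp hτ.continuousOn hmaps).rexp
  have hofReal := eqOn_of_forall_setLIntegral_eq τ.open_source
    (ENNReal.continuous_ofReal.comp_continuousOn hcont')
    (ENNReal.continuous_ofReal.comp_continuousOn hcont)
    (fun T hTO hT => setLIntegral_logDensity_change he he' hΦ hΦ' hTO hT) hy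
  have hexp : Real.exp (logDensity m e' y) =
      |(fderiv ℝ τ y).det| * Real.exp (logDensity m e (τ y)) :=
    (ENNReal.ofReal_eq_ofReal_iff (Real.exp_pos _).le (by positivity)).1 hofReal
  have hdet : (fderiv ℝ τ y).det ≠ 0 := by
    rw [fderiv_transition he he' hy]
    exact (LinearEquiv.isUnit_det' (transitionDeriv he he' hy).toLinearEquiv).ne_zero
  rw [← Real.log_exp (logDensity m e' y), hexp, Real.log_mul (abs_ne_zero.2 hdet)
    (Real.exp_ne_zero _), Real.log_exp, add_comm]

theorem divergence_eq_coordDiv (hm : IsSmoothPositiveMeasure n m) (he : e ∈ atlas (Model n) M)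
    (hy : y ∈ e.target) {V : M → Model n} (hV : DifferentiableAt ℝ (fieldInChart e V) y) :
    divergence m V (e.symm y) = coordDiv (logDensity m e) (fieldInChart e V) y := by
  set x := e.symm y with hx
  set e' := chartAt (Model n) x
  have he' : e' ∈ atlas (Model n) M := chart_mem_atlas _ x
  have hxe' : x ∈ e'.source := mem_chart_source _ x
  have hmem : e' x ∈ (e'.symm ≫ₕ e).source := by
    refine ⟨e'.map_source hxe', ?_⟩
    change e'.symm (e' x) ∈ e.source
    rw [e'.left_inv hxe']
    exact e.map_target hy
  have hτ : (e'.symm ≫ₕ e) (e' x) = y := by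
    change e (e'.symm (e' x)) = y
    rw [e'.left_inv hxe', hx, e.right_inv hy]
  have hsource := (e'.symm ≫ₕ e).open_source.mem_nhds hmem
  change coordDiv (logDensity m e') (fieldInChart e' V) (e' x) = _
  rw [← hτ] at hV hy ⊢
  exact coordDiv_change
    ((contDiffAt_transition he he' hmem).of_le (WithTop.coe_le_coe.2 le_top))
    (fderiv_transition he he' hmem) hV
    ((contDiffAt_logDensity hm he hy).differentiableAt (by simp))
    (Filter.mem_of_superset hsource fun z hz => fderiv_transition_fieldInChart he he' hz V)
    (Filter.mem_of_superset hsource fun z hz => logDensity_change hm he he' hz)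

end Density

/-! ### The Bochner inequality -/

namespace FinslerStructure

variable {n : ℕ} {M : Type*} [TopologicalSpace M] [ChartedSpace (Model n) M]
  [IsManifold (𝓡 n) ∞ M] (F : FinslerStructure n M)

/-- The function `F(∇u)`. -/
def gradNorm (u : M → ℝ) (x : M) : ℝ := F.fibreNorm x (F.grad u x)

/-- The squared Hilbert–Schmidt norm of the Hessian `∇²u = ∇(∇u)` with respect to `g_{∇u}`, as the
trace of the square of this `g_{∇u}`-self-adjoint endomorphism, in the preferred chart at `x`. -/
def hessianNormSq (u : M → ℝ) (x : M) : ℝ :=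
  let e := chartAt (Model n) x
  let H := covDeriv (F.inChart e) (fieldInChart e (F.grad u)) (e x)
  (H * H).trace

section Chart

variable {e : OpenPartialHomeomorph M (Model n)} {u : M → ℝ} {y : Model n}

theorem gradNorm_comp_chart_symm (he : e ∈ atlas (Model n) M) (hy : y ∈ e.target) :
    F.gradNorm u ∘ e.symm =ᶠ[𝓝 y] fun z => F.inChart e z (fieldInChart e (F.grad u) z) := by
  filter_upwards [e.open_target.mem_nhds hy] with z hz
  exact (F.inChart_fieldInChart he hz _).symm

theorem gradNorm_sq_comp_chart_symm (he : e ∈ atlas (Model n) M) (hy : y ∈ e.target) :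
    (fun z => F.gradNorm u z ^ 2 / 2) ∘ e.symm =ᶠ[𝓝 y]
      fun z => energy (F.inChart e) z (fieldInChart e (F.grad u) z) := by
  filter_upwards [F.gradNorm_comp_chart_symm (u := u) he hy] with z hz
  change (F.gradNorm u ∘ e.symm) z ^ 2 / 2 = 1 / 2 * F.inChart e z _ ^ 2
  rw [hz]
  ring

variable (he : e ∈ atlas (Model n) M) (hu : ContMDiff (𝓡 n) 𝓘(ℝ, ℝ) ∞ u)
  (hy : y ∈ regularSet e u)

include he hu hy

theorem contDiffAt_fieldInChart_grad : ContDiffAt ℝ ∞ (fieldInChart e (F.grad u)) y :=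
  (F.isGradientOn_grad he hu).contDiffAt (F.isFinslerOn_regularSet he hu) hy

theorem differentiableAt_comp_field {H : Model n → Model n → ℝ} {φ : M → ℝ}
    (hH : SmoothAt H y (fieldInChart e (F.grad u) y))
    (h : φ ∘ e.symm =ᶠ[𝓝 y] fun z => H z (fieldInChart e (F.grad u) z)) :
    DifferentiableAt ℝ (φ ∘ e.symm) y :=
  ((hH.comp_field (F.contDiffAt_fieldInChart_grad he hu hy)).differentiableAt
    (by simp)).congr_of_eventuallyEq h

theorem dform_gradNorm_linGrad_le_trace :
    dform (F.gradNorm u) (e.symm y) (F.linGrad u (F.gradNorm u) (e.symm y)) ≤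
      (covDeriv (F.inChart e) (fieldInChart e (F.grad u)) y *
        covDeriv (F.inChart e) (fieldInChart e (F.grad u)) y).trace := by
  have hf := F.isFinslerOn_regularSet he hu
  have hW := F.isGradientOn_grad he hu
  have hnorm := F.gradNorm_comp_chart_symm (u := u) he hy.1
  have hdiff := F.differentiableAt_comp_field he hu hy (hf.smoothAt y hy _ (hW.ne_zero y hy)) hnorm
  rw [dform_field he hy.1 hdiff, hnorm.fderiv_eq]
  refine hW.fderiv_norm_le_trace hf hy fun b => ?_
  rw [F.halfHess_linGrad_inChart he hu hy hdiff, hnorm.fderiv_eq]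

theorem fieldInChart_linGrad_gradNorm_sq :
    fieldInChart e (F.linGrad u fun z => F.gradNorm u z ^ 2 / 2) y =
      accel (F.inChart e) (fieldInChart e (F.grad u)) y := by
  have hf := F.isFinslerOn_regularSet he hu
  have hW := F.isGradientOn_grad he hu
  have henergy := F.gradNorm_sq_comp_chart_symm (u := u) he hy.1
  refine (hf.minkowski y hy).eq_of_halfHess_eq (hW.ne_zero y hy) fun b => ?_
  rw [hW.halfHess_accel hf hy, ← henergy.fderiv_eq]
  exact F.halfHess_linGrad_inChart he hu hy
    (F.differentiableAt_comp_field he hu hy (hf.smoothAt_energy hy (hW.ne_zero y hy)) henergy) b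

variable [MeasurableSpace M] [BorelSpace M] {m : MeasureTheory.Measure M}

theorem laplacian_comp_chart_symm (hm : IsSmoothPositiveMeasure n m) :
    F.laplacian m u ∘ e.symm =ᶠ[𝓝 y]
      coordDiv (logDensity m e) (fieldInChart e (F.grad u)) := by
  filter_upwards [(isOpen_regularSet he hu).mem_nhds hy] with z hz
  exact divergence_eq_coordDiv hm he hz.1
    ((F.contDiffAt_fieldInChart_grad he hu hz).differentiableAt (by simp))

theorem dform_laplacian_grad (hm : IsSmoothPositiveMeasure n m) :
    dform (F.laplacian m u) (e.symm y) (F.grad u (e.symm y)) =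
      fderiv ℝ (coordDiv (logDensity m e) (fieldInChart e (F.grad u))) y
        (fieldInChart e (F.grad u) y) := by
  have hlap := F.laplacian_comp_chart_symm he hu hy hm
  have hdiff := (contDiffAt_coordDiv (contDiffAt_logDensity hm he hy.1)
    (F.contDiffAt_fieldInChart_grad he hu hy)).differentiableAt (by simp)
  rw [dform_field he hy.1 (hdiff.congr_of_eventuallyEq hlap), hlap.fderiv_eq]

end Chart

variable {u : M → ℝ} {x : M}

theorem dform_gradNorm_linGrad_le (hu : ContMDiff (𝓡 n) 𝓘(ℝ, ℝ) ∞ u)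
    (hx : dform (n := n) u x ≠ 0) :
    dform (F.gradNorm u) x (F.linGrad u (F.gradNorm u) x) ≤ F.hessianNormSq u x := by
  have htrace := F.dform_gradNorm_linGrad_le_trace (chart_mem_atlas (Model n) x) hu
    (chartAt_mem_regularSet hu hx)
  rwa [(chartAt (Model n) x).left_inv (mem_chart_source _ x)] at htrace

variable [MeasurableSpace M] {m : MeasureTheory.Measure M}

theorem ricciInfty_of_ne_zero (hm : IsSmoothPositiveMeasure n m) {v : TangentSpace (𝓡 n) x}
    (hv : v ≠ 0) : F.ricciInfty m x v =
      ricciCoord (F.inChart (chartAt (Model n) x)) (chartAt (Model n) x x)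
          (vecInChart (chartAt (Model n) x) x v) +
        sprayDeriv (F.inChart (chartAt (Model n) x))
          (weightFlow (F.inChart (chartAt (Model n) x)) (logDensity m (chartAt (Model n) x)))
          (chartAt (Model n) x x) (vecInChart (chartAt (Model n) x) x v) := by
  rw [ricciInfty, if_neg hv, F.deriv_deriv_weightAlong (F.isGeodesicAt_geodesic hv) hv
    (isLogDensity_logDensity hm (chart_mem_atlas (Model n) x)).1]
  rfl

theorem linLaplacian_gradNorm_sq (hu : ContMDiff (𝓡 n) 𝓘(ℝ, ℝ) ∞ u)
    (hx : dform (n := n) u x ≠ 0) :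
    F.linLaplacian m (F.gradient u) (fun z => F.gradNorm u z ^ 2 / 2) x =
      coordDiv (logDensity m (chartAt (Model n) x)) (accel (F.inChart (chartAt (Model n) x))
        (fieldInChart (chartAt (Model n) x) (F.grad u))) (chartAt (Model n) x x) := by
  have he := chart_mem_atlas (Model n) x
  refine coordDiv_congr (W := fieldInChart (chartAt (Model n) x)
    (F.linGrad u fun z => F.gradNorm u z ^ 2 / 2)) ?_
  filter_upwards [(isOpen_regularSet he hu).mem_nhds (chartAt_mem_regularSet hu hx)] with y hy
  exact F.fieldInChart_linGrad_gradNorm_sq he hu hy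

theorem linLaplacian_sub_dform_laplacian [BorelSpace M] (hm : IsSmoothPositiveMeasure n m)
    (hu : ContMDiff (𝓡 n) 𝓘(ℝ, ℝ) ∞ u) (hx : dform (n := n) u x ≠ 0) :
    F.linLaplacian m (F.gradient u) (fun z => F.gradNorm u z ^ 2 / 2) x -
        dform (F.laplacian m u) x (F.grad u x) =
      F.hessianNormSq u x + F.ricciInfty m x (F.gradient u x) := by
  have he := chart_mem_atlas (Model n) x
  have hy := chartAt_mem_regularSet hu hx
  have hleft := (chartAt (Model n) x).left_inv (mem_chart_source _ x)
  have hgrad : F.gradient u x ≠ 0 := (F.grad_spec hx).1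
  have hfield : fieldInChart (chartAt (Model n) x) (F.grad u) (chartAt (Model n) x x) =
      vecInChart (chartAt (Model n) x) x (F.gradient u x) := by
    rw [fieldInChart, hleft, grad]
  have hlap := F.dform_laplacian_grad he hu hy hm
  rw [hleft] at hlap
  rw [F.linLaplacian_gradNorm_sq hu hx, hlap, F.ricciInfty_of_ne_zero hm hgrad, ← hfield,
    (F.isFinslerOn_regularSet he hu).coordDiv_accel_sub (contDiffAt_logDensity hm he hy.1)
      (F.contDiffAt_fieldInChart_grad he hu hy) hy ((F.isGradientOn_grad he hu).ne_zero _ hy),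
    hessianNormSq, add_assoc]

end FinslerStructure

end Finsler

end

theorem mainTheorem4_general {n : ℕ} {M : Type*} [TopologicalSpace M]
    [ChartedSpace (Finsler.Model n) M] [IsManifold (𝓡 n) ∞ M] [MeasurableSpace M] [BorelSpace M]
    (F : Finsler.FinslerStructure n M) (m : MeasureTheory.Measure M)
    (hm : Finsler.IsSmoothPositiveMeasure n m)
    (u : M → ℝ) (hu : ContMDiff (𝓡 n) 𝓘(ℝ, ℝ) ∞ u)
    (x : M) (hx : Finsler.differential (n := n) u x ≠ 0) :
    Finsler.differential (n := n) (fun y => F.toFun y (F.gradient u y)) x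
        (F.linGradient (F.gradient u) (fun y => F.toFun y (F.gradient u y)) x)
      ≤ F.linLaplacian m (F.gradient u) (fun y => F.toFun y (F.gradient u y) ^ 2 / 2) x
        - Finsler.differential (n := n) (F.laplacian m u) x (F.gradient u x)
        - F.ricciInfty m x (F.gradient u x) :=
  calc
    _ ≤ F.hessianNormSq u x := F.dform_gradNorm_linGrad_le hu hx
    _ = _ := eq_sub_of_add_eq (F.linLaplacian_sub_dform_laplacian hm hu hx).symm

theorem mainTheorem4 {n : ℕ} (hn : 2 ≤ n) {M : Type*} [TopologicalSpace M] [T2Space M]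
    [SecondCountableTopology M] [ConnectedSpace M] [ChartedSpace (Finsler.Model n) M]
    [IsManifold (𝓡 n) ∞ M] [MeasurableSpace M] [BorelSpace M]
    (F : Finsler.FinslerStructure n M) (m : MeasureTheory.Measure M)
    (hm : Finsler.IsSmoothPositiveMeasure n m)
    (K : ℝ) (hK : F.RicciInftyGE m K)
    (u : M → ℝ) (hu : ContMDiff (𝓡 n) 𝓘(ℝ, ℝ) ∞ u)
    (x : M) (hx : Finsler.differential (n := n) u x ≠ 0) :
    Finsler.differential (n := n) (fun y => F.toFun y (F.gradient u y)) x
        (F.linGradient (F.gradient u) (fun y => F.toFun y (F.gradient u y)) x)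
      ≤ F.linLaplacian m (F.gradient u) (fun y => F.toFun y (F.gradient u y) ^ 2 / 2) x
        - Finsler.differential (n := n) (F.laplacian m u) x (F.gradient u x)
        - K * F.toFun x (F.gradient u x) ^ 2 :=
  (mainTheorem4_general F m hm u hu x hx).trans (sub_le_sub_left (hK x (F.gradient u x)) _)
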